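/- Let $\mathfrak{age}(1)$ be the complex Lie algebra with basis $e,h,p,q,z$ and brackets $[h,e]=2e$, $[h,p]=p$, $[h,q]=-q$, $[e,p]=0$, $[e,q]=p$, $[p,q]=z$, with $z$ central. Let $\widehat{\mathfrak{age}}(1)=\mathfrak{age}(1)\otimes\mathbb{C}[t,t^{-1}]\oplus\mathbb{C}k$ be the Lie algebra in which $k$ is central and $[\alpha_m,\beta_n]=[\alpha,\beta]_{m+n}+m(\alpha|\beta)\delta_{m+n,0}k$, where $\alpha_m=\alpha\otimes t^m$ and $(\cdot|\cdot)$ is the bilinear form with $(h|h)=1$ and value $0$ on all other pairs of basis vectors. For $d_1,d_2,d_3\in\mathbb{Z}$ with $d_1+d_3\ge d_2$ let $$\widehat{\mathfrak{age}}(1)_{(d_1,d_2,d_3)}=\sum_{i\ge 0}(\mathbb{C}h_i\oplus\mathbb{C}e_{d_1+i}\oplus\mathbb{C}p_{d_2+i}\oplus\mathbb{C}q_{d_3+i})\oplus\sum_{i\in\mathbb{Z}}\mathbb{C}z_i\oplus\mathbb{C}k ,$$ a subalgebra of $\widehat{\mathfrak{age}}(1)$, and for a module $V$ over it let $\mathrm{Ind}(V)=U(\widehat{\mathfrak{age}}(1))\otimes_{U(\widehat{\mathfrak{age}}(1)_{(d_1,d_2,d_3)})}V$.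 An $\widehat{\mathfrak{age}}(1)$-module is called restricted if each of its vectors is annihilated by $e_m,p_m,q_m,h_m,z_m$ for all sufficiently large $m$. Let $S$ be a simple restricted $\widehat{\mathfrak{age}}(1)$-module and $a\in\mathbb{Z}$ such that $p_a$ acts injectively on $S$. Suppose that not all $z_m$ act on $S$ as zero, and let $r\in\mathbb{Z}$ be the integer such that $z_{r-1}S\ne 0$ and $z_{r+i}S=0$ for all $i\ge 0$. For $x_1,x_2,x_3,x_4\in\mathbb{Z}$ put $$N_{x_1,x_2,x_3,x_4}=\{v\in S\mid p_{x_1+i}v=e_{x_2+i}v=h_{x_3+i}v=q_{x_4+i}v=0\text{ for all } i\ge 1\}.$$ Let $l$ be the smallest integer $\ge a$ such that $N_{l,x_2,x_3,x_4}\neq 0$ for some $x_2,x_3,x_4\in\mathbb{Z}$, and let $l'$ be the smallest integer such that $N_{l,l',x_3,x_4}\ne 0$ for some $x_3,x_4\in\mathbb{Z}$. **Theorem.** If $r\le 2l-l'$, then there exist $d_1,d_2,d_3\in\mathbb{Z}$ with $d_1+d_3\ge d_2$ and a simple $\widehat{\mathfrak{age}}(1)_{(d_1,d_2,d_3)}$-module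 $V$ such that $S\cong\mathrm{Ind}(V)$ as $\widehat{\mathfrak{age}}(1)$-modules and such that, for some integer $\lambda>d_2$: (a) $p_\lambda$ acts injectively on $V$; (b) for all $i\ge 1$, the elements $p_{\lambda+i}$, $z_{\lambda+d_2-d_1+i-1}$, $e_{\lambda-d_3+i}$, $q_{\lambda-d_1+i}$, $h_{\lambda-d_2+i}$ lie in $\widehat{\mathfrak{age}}(1)_{(d_1,d_2,d_3)}$ and annihilate $V$. -/

import Mathlib

open scoped TensorProduct

universe u

noncomputable section

/-! ### The ageing algebra `age(1)` -/

/-- The underlying vector space of the 1-spatial ageing algebra: a vector lists its coordinates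
with respect to the basis `e, h, p, q, z`, in this order. -/
def Age : Type := Fin 5 → ℂ

namespace Age

instance : AddCommGroup Age := inferInstanceAs (AddCommGroup (Fin 5 → ℂ))

instance : Module ℂ Age := inferInstanceAs (Module ℂ (Fin 5 → ℂ))

/-- The basis vector `e`. -/
def e : Age := (![1, 0, 0, 0, 0] : Fin 5 → ℂ)

/-- The basis vector `h`. -/
def h : Age := (![0, 1, 0, 0, 0] : Fin 5 → ℂ)

/-- The basis vector `p`. -/
def p : Age := (![0, 0, 1, 0, 0] : Fin 5 → ℂ)

/-- The basis vector `q`. -/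
def q : Age := (![0, 0, 0, 1, 0] : Fin 5 → ℂ)

/-- The basis vector `z`. -/
def z : Age := (![0, 0, 0, 0, 1] : Fin 5 → ℂ)

/-- The bilinear extension of the bracket relations
`[h,e] = 2e`, `[h,p] = p`, `[h,q] = -q`, `[e,p] = 0`, `[e,q] = p`, `[p,q] = z`, `z` central. -/
instance : Bracket Age Age where
  bracket x y :=
    (![2 * (x 1 * y 0 - x 0 * y 1),
       0,
       (x 1 * y 2 - x 2 * y 1) + (x 0 * y 3 - x 3 * y 0),
       -(x 1 * y 3 - x 3 * y 1),
       x 2 * y 3 - x 3 * y 2] : Fin 5 → ℂ)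

@[simp] theorem lie_apply_zero (x y : Age) : ⁅x, y⁆ 0 = 2 * (x 1 * y 0 - x 0 * y 1) := rfl

@[simp] theorem lie_apply_one (x y : Age) : ⁅x, y⁆ 1 = 0 := rfl

@[simp] theorem lie_apply_two (x y : Age) :
    ⁅x, y⁆ 2 = (x 1 * y 2 - x 2 * y 1) + (x 0 * y 3 - x 3 * y 0) := rfl

@[simp] theorem lie_apply_three (x y : Age) : ⁅x, y⁆ 3 = -(x 1 * y 3 - x 3 * y 1) := rfl

@[simp] theorem lie_apply_four (x y : Age) : ⁅x, y⁆ 4 = x 2 * y 3 - x 3 * y 2 := rfl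

@[ext] theorem ext {x y : Age} (H : ∀ i : Fin 5, x i = y i) : x = y := funext H

@[simp] theorem add_apply (x y : Age) (i : Fin 5) : (x + y) i = x i + y i := rfl

@[simp] theorem smul_apply (c : ℂ) (x : Age) (i : Fin 5) : (c • x) i = c * x i := rfl

@[simp] theorem zero_apply (i : Fin 5) : (0 : Age) i = 0 := rfl

instance : LieRing Age where
  add_lie x y w := by
    ext i
    fin_cases i <;> simp <;> ring
  lie_add x y w := by
    ext i
    fin_cases i <;> simp <;> ring
  lie_self x := by
    ext i
    fin_cases i <;> simp <;> ring
  leibniz_lie x y w := by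
    ext i
    fin_cases i <;> simp <;> ring

instance : LieAlgebra ℂ Age where
  lie_smul c x y := by
    ext i
    fin_cases i <;> simp <;> ring

/-- The symmetric bilinear form with `(h|h) = 1` and all other values on basis vectors zero. -/
def form : LinearMap.BilinForm ℂ Age :=
  LinearMap.mk₂ ℂ (fun x y : Age => x 1 * y 1)
    (fun x y w => by simp [add_mul]) (fun c x y => by simp [mul_assoc])
    (fun x y w => by simp [mul_add]) (fun c x y => by simp [mul_left_comm])

@[simp] theorem form_apply (x y : Age) : form x y = x 1 * y 1 := rfl

theorem neg_form_isSymm : (-form).IsSymm := ⟨fun x y => by simp [mul_comm]⟩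

theorem neg_form_lieInvariant : (-form).lieInvariant Age := fun x y w => by
  show -form ⁅x, y⁆ w = -(-form y ⁅x, w⁆)
  simp

theorem lie_h_e : ⁅h, e⁆ = (2 : ℂ) • e := by
  ext i
  fin_cases i <;> simp <;> simp [h, e]

theorem lie_h_p : ⁅h, p⁆ = p := by
  ext i
  fin_cases i <;> simp <;> simp [h, p]

theorem lie_h_q : ⁅h, q⁆ = -q := by
  rw [← neg_one_smul ℂ]
  ext i
  fin_cases i <;> simp <;> simp [h, q]

theorem lie_e_p : ⁅e, p⁆ = 0 := by
  ext i
  fin_cases i <;> simp <;> simp [e, p]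

theorem lie_e_q : ⁅e, q⁆ = p := by
  ext i
  fin_cases i <;> simp <;> simp [e, p, q]

theorem lie_p_q : ⁅p, q⁆ = z := by
  ext i
  fin_cases i <;> simp <;> simp [z, p, q]

theorem lie_z (x : Age) : ⁅z, x⁆ = 0 := by
  ext i
  fin_cases i <;> simp <;> simp [z]

end Age

/-! ### The affine ageing algebra -/

/-- The 2-cocycle `(α ⊗ t^m, β ⊗ t^n) ↦ m (α|β) δ_{m+n,0}` on the loop algebra of `age(1)`.
Mathlib's cocycle attached to a form `Φ` takes the value `n Φ(α, β) δ_{m+n,0}`, so it is applied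
to `Φ = -(·|·)`; see `AgeHat.bracket_gen`. -/
def ageCocycle : LieModule.Cohomology.twoCocycle ℂ (LieAlgebra.loopAlgebra ℂ ℤ Age)
    (TrivialLieModule ℂ (LieAlgebra.loopAlgebra ℂ ℤ Age) ℂ) :=
  LieAlgebra.LoopAlgebra.twoCocycleOfBilinear ℂ ℤ Age (-Age.form)
    Age.neg_form_lieInvariant Age.neg_form_isSymm

/-- The affine ageing algebra `age(1) ⊗ ℂ[t, t⁻¹] ⊕ ℂ k`. -/
abbrev AgeHat : Type := LieAlgebra.ofTwoCocycle ageCocycle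

namespace AgeHat

/-- The element `α_m = α ⊗ t^m`. -/
def gen (α : Age) (m : ℤ) : AgeHat :=
  LieAlgebra.ofProd ageCocycle (AddMonoidAlgebra.single m (1 : ℂ) ⊗ₜ[ℂ] α, 0)

/-- The central element `k`. -/
def k : AgeHat :=
  LieAlgebra.ofProd ageCocycle
    (0, (TrivialLieModule.equiv ℂ (LieAlgebra.loopAlgebra ℂ ℤ Age) ℂ).symm 1)

/-- The element `e_m`. -/
def e (m : ℤ) : AgeHat := gen Age.e m

/-- The element `h_m`. -/
def h (m : ℤ) : AgeHat := gen Age.h m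

/-- The element `p_m`. -/
def p (m : ℤ) : AgeHat := gen Age.p m

/-- The element `q_m`. -/
def q (m : ℤ) : AgeHat := gen Age.q m

/-- The element `z_m`. -/
def z (m : ℤ) : AgeHat := gen Age.z m

theorem gen_smul (c : ℂ) (α : Age) (m : ℤ) : gen (c • α) m = c • gen α m := by
  simp [gen, ← LieAlgebra.of_smul]

theorem gen_zero (m : ℤ) : gen 0 m = 0 := by
  simp [gen, ← LieAlgebra.of_zero]

/-- `[α_m, β_n] = [α, β]_{m+n} + m (α|β) δ_{m+n,0} k`. -/
theorem bracket_gen (α β : Age) (m n : ℤ) :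
    ⁅gen α m, gen β n⁆ =
      gen ⁅α, β⁆ (m + n) + (if m + n = 0 then (m : ℂ) * Age.form α β else 0) • k := by
  have key : LieAlgebra.LoopAlgebra.residuePairing ℂ ℤ Age (-Age.form)
      (AddMonoidAlgebra.single m (1 : ℂ) ⊗ₜ[ℂ] α) (AddMonoidAlgebra.single n (1 : ℂ) ⊗ₜ[ℂ] β) =
      if m + n = 0 then (m : ℂ) * Age.form α β else 0 := by
    rw [LieAlgebra.LoopAlgebra.residuePairing_apply_apply,
      LieAlgebra.LoopAlgebra.toFinsupp_single_tmul, LieAlgebra.LoopAlgebra.toFinsupp_single_tmul,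
      Finsupp.sum_single_index (by simp)]
    by_cases hmn : m + n = 0
    · obtain rfl : m = -n := by omega
      simp
    · rw [Finsupp.single_eq_of_ne (by omega), if_neg hmn]
      simp
  have hc : (ageCocycle : LieModule.Cohomology.twoCochain ℂ (LieAlgebra.loopAlgebra ℂ ℤ Age)
        (TrivialLieModule ℂ (LieAlgebra.loopAlgebra ℂ ℤ Age) ℂ))
      (AddMonoidAlgebra.single m (1 : ℂ) ⊗ₜ[ℂ] α) (AddMonoidAlgebra.single n (1 : ℂ) ⊗ₜ[ℂ] β) =
      (if m + n = 0 then (m : ℂ) * Age.form α β else 0) •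
        (TrivialLieModule.equiv ℂ (LieAlgebra.loopAlgebra ℂ ℤ Age) ℂ).symm 1 := by
    rw [← map_smul, smul_eq_mul, mul_one, ← key]
    rfl
  rw [LieAlgebra.bracket_ofTwoCocycle]
  simp only [gen, k, ← LieAlgebra.of_smul, ← LieAlgebra.of_add, Equiv.symm_apply_apply, lie_zero,
    add_zero, sub_zero, Prod.smul_mk, Prod.mk_add_mk, smul_zero, zero_add]
  rw [← hc, LieAlgebra.ExtendScalars.bracket_tmul, AddMonoidAlgebra.single_mul_single, mul_one]
  rfl

theorem bracket_k (x : AgeHat) : ⁅x, k⁆ = 0 := by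
  rw [LieAlgebra.bracket_ofTwoCocycle]
  simp only [k, Equiv.symm_apply_apply, lie_zero, map_zero, trivial_lie_zero, sub_zero,
    add_zero]
  exact LieAlgebra.of_zero ageCocycle

theorem gen_neg (α : Age) (m : ℤ) : gen (-α) m = -gen α m := by
  rw [← neg_one_smul ℂ α, gen_smul, neg_one_smul]

theorem lie_h_h (m n : ℤ) : ⁅h m, h n⁆ = (if m + n = 0 then (m : ℂ) else 0) • k := by
  simp only [h, bracket_gen, lie_self, gen_zero, zero_add, Age.form_apply]
  simp [Age.h]

theorem lie_h_e (m n : ℤ) : ⁅h m, e n⁆ = (2 : ℂ) • e (m + n) := by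
  simp only [h, e, bracket_gen, Age.lie_h_e, gen_smul, Age.form_apply]
  simp [Age.e]

theorem lie_h_p (m n : ℤ) : ⁅h m, p n⁆ = p (m + n) := by
  simp only [h, p, bracket_gen, Age.lie_h_p, Age.form_apply]
  simp [Age.p]

theorem lie_h_q (m n : ℤ) : ⁅h m, q n⁆ = -q (m + n) := by
  simp only [h, q, bracket_gen, Age.lie_h_q, gen_neg, Age.form_apply]
  simp [Age.q]

theorem lie_e_e (m n : ℤ) : ⁅e m, e n⁆ = 0 := by
  simp only [e, bracket_gen, lie_self, gen_zero, Age.form_apply]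
  simp [Age.e]

theorem lie_e_p (m n : ℤ) : ⁅e m, p n⁆ = 0 := by
  simp only [e, p, bracket_gen, Age.lie_e_p, gen_zero, Age.form_apply]
  simp [Age.e]

theorem lie_e_q (m n : ℤ) : ⁅e m, q n⁆ = p (m + n) := by
  simp only [e, p, q, bracket_gen, Age.lie_e_q, Age.form_apply]
  simp [Age.e]

theorem lie_p_p (m n : ℤ) : ⁅p m, p n⁆ = 0 := by
  simp only [p, bracket_gen, lie_self, gen_zero, Age.form_apply]
  simp [Age.p]

theorem lie_p_q (m n : ℤ) : ⁅p m, q n⁆ = z (m + n) := by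
  simp only [p, q, z, bracket_gen, Age.lie_p_q, Age.form_apply]
  simp [Age.p]

theorem lie_q_q (m n : ℤ) : ⁅q m, q n⁆ = 0 := by
  simp only [q, bracket_gen, lie_self, gen_zero, Age.form_apply]
  simp [Age.q]

theorem lie_z_gen (m : ℤ) (α : Age) (n : ℤ) : ⁅z m, gen α n⁆ = 0 := by
  simp only [z, bracket_gen, Age.lie_z, gen_zero, Age.form_apply]
  simp [Age.z]

/-! ### The subalgebras `age(1)^_{(d₁, d₂, d₃)}` -/

/-- The spanning set `h_i, e_{d₁+i}, p_{d₂+i}, q_{d₃+i}` (`i ∈ ℕ`), `z_i` (`i ∈ ℤ`), `k`. -/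
inductive SubGen (d₁ d₂ d₃ : ℤ) : AgeHat → Prop
  | h (i : ℕ) : SubGen d₁ d₂ d₃ (h i)
  | e (i : ℕ) : SubGen d₁ d₂ d₃ (e (d₁ + i))
  | p (i : ℕ) : SubGen d₁ d₂ d₃ (p (d₂ + i))
  | q (i : ℕ) : SubGen d₁ d₂ d₃ (q (d₃ + i))
  | z (i : ℤ) : SubGen d₁ d₂ d₃ (z i)
  | k : SubGen d₁ d₂ d₃ k

/-- The linear span of the vectors `SubGen d₁ d₂ d₃`. -/
def subSpan (d₁ d₂ d₃ : ℤ) : Submodule ℂ AgeHat :=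
  Submodule.span ℂ {x | SubGen d₁ d₂ d₃ x}

theorem h_mem {d₁ d₂ d₃ n : ℤ} (hn : 0 ≤ n) : h n ∈ subSpan d₁ d₂ d₃ := by
  obtain ⟨i, rfl⟩ := Int.eq_ofNat_of_zero_le hn
  exact Submodule.subset_span (SubGen.h i)

theorem e_mem {d₁ d₂ d₃ n : ℤ} (hn : d₁ ≤ n) : e n ∈ subSpan d₁ d₂ d₃ := by
  obtain ⟨i, rfl⟩ := Int.le.dest hn
  exact Submodule.subset_span (SubGen.e i)

theorem p_mem {d₁ d₂ d₃ n : ℤ} (hn : d₂ ≤ n) : p n ∈ subSpan d₁ d₂ d₃ := by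
  obtain ⟨i, rfl⟩ := Int.le.dest hn
  exact Submodule.subset_span (SubGen.p i)

theorem q_mem {d₁ d₂ d₃ n : ℤ} (hn : d₃ ≤ n) : q n ∈ subSpan d₁ d₂ d₃ := by
  obtain ⟨i, rfl⟩ := Int.le.dest hn
  exact Submodule.subset_span (SubGen.q i)

theorem z_mem {d₁ d₂ d₃ : ℤ} (n : ℤ) : z n ∈ subSpan d₁ d₂ d₃ :=
  Submodule.subset_span (SubGen.z n)

theorem k_mem {d₁ d₂ d₃ : ℤ} : k ∈ subSpan d₁ d₂ d₃ :=
  Submodule.subset_span SubGen.k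

theorem lie_mem_subSpan_of_subGen {d₁ d₂ d₃ : ℤ} (hd : d₂ ≤ d₁ + d₃) {x y : AgeHat}
    (hx : SubGen d₁ d₂ d₃ x) (hy : SubGen d₁ d₂ d₃ y) : ⁅x, y⁆ ∈ subSpan d₁ d₂ d₃ := by
  have hk : ∀ w : AgeHat, ⁅k, w⁆ = 0 := fun w => by rw [← lie_skew, bracket_k, neg_zero]
  have hz : ∀ (α : Age) (m n : ℤ), ⁅gen α m, z n⁆ = 0 := fun α m n => by
    rw [← lie_skew, lie_z_gen, neg_zero]
  have sk : ∀ u w : AgeHat, ⁅u, w⁆ ∈ subSpan d₁ d₂ d₃ → ⁅w, u⁆ ∈ subSpan d₁ d₂ d₃ :=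
    fun u w H => by
      rw [← lie_skew]
      exact neg_mem H
  have hhe : ∀ i j : ℕ, ⁅h i, e (d₁ + j)⁆ ∈ subSpan d₁ d₂ d₃ := fun i j => by
    rw [lie_h_e]
    exact Submodule.smul_mem _ _ (e_mem (by omega))
  have hhp : ∀ i j : ℕ, ⁅h i, p (d₂ + j)⁆ ∈ subSpan d₁ d₂ d₃ := fun i j => by
    rw [lie_h_p]
    exact p_mem (by omega)
  have hhq : ∀ i j : ℕ, ⁅h i, q (d₃ + j)⁆ ∈ subSpan d₁ d₂ d₃ := fun i j => by
    rw [lie_h_q]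
    exact neg_mem (q_mem (by omega))
  have hep : ∀ i j : ℕ, ⁅e (d₁ + i), p (d₂ + j)⁆ ∈ subSpan d₁ d₂ d₃ := fun i j => by
    rw [lie_e_p]
    exact zero_mem _
  have heq : ∀ i j : ℕ, ⁅e (d₁ + i), q (d₃ + j)⁆ ∈ subSpan d₁ d₂ d₃ := fun i j => by
    rw [lie_e_q]
    exact p_mem (by omega)
  have hpq : ∀ i j : ℕ, ⁅p (d₂ + i), q (d₃ + j)⁆ ∈ subSpan d₁ d₂ d₃ := fun i j => by
    rw [lie_p_q]
    exact z_mem _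
  have hzl : ∀ (α : Age) (m n : ℤ), ⁅gen α m, z n⁆ ∈ subSpan d₁ d₂ d₃ := fun α m n => by
    rw [hz]
    exact zero_mem _
  cases hx with
  | k =>
    rw [hk]
    exact zero_mem _
  | z i =>
    cases hy with
    | k =>
      rw [bracket_k]
      exact zero_mem _
    | h j => exact sk _ _ (hzl _ _ _)
    | e j => exact sk _ _ (hzl _ _ _)
    | p j => exact sk _ _ (hzl _ _ _)
    | q j => exact sk _ _ (hzl _ _ _)
    | z j => exact sk _ _ (hzl _ _ _)
  | h i =>
    cases hy with
    | k =>
      rw [bracket_k]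
      exact zero_mem _
    | h j =>
      rw [lie_h_h]
      exact Submodule.smul_mem _ _ k_mem
    | e j => exact hhe i j
    | p j => exact hhp i j
    | q j => exact hhq i j
    | z j => exact hzl _ _ _
  | e i =>
    cases hy with
    | k =>
      rw [bracket_k]
      exact zero_mem _
    | h j => exact sk _ _ (hhe j i)
    | e j =>
      rw [lie_e_e]
      exact zero_mem _
    | p j => exact hep i j
    | q j => exact heq i j
    | z j => exact hzl _ _ _
  | p i =>
    cases hy with
    | k =>
      rw [bracket_k]
      exact zero_mem _
    | h j => exact sk _ _ (hhp j i)
    | e j => exact sk _ _ (hep j i)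
    | p j =>
      rw [lie_p_p]
      exact zero_mem _
    | q j => exact hpq i j
    | z j => exact hzl _ _ _
  | q i =>
    cases hy with
    | k =>
      rw [bracket_k]
      exact zero_mem _
    | h j => exact sk _ _ (hhq j i)
    | e j => exact sk _ _ (heq j i)
    | p j => exact sk _ _ (hpq j i)
    | q j =>
      rw [lie_q_q]
      exact zero_mem _
    | z j => exact hzl _ _ _

/-- The subalgebra spanned by `h_i, e_{d₁+i}, p_{d₂+i}, q_{d₃+i}` (`i ∈ ℕ`), `z_i` (`i ∈ ℤ`) and
`k`; this span is closed under the bracket when `d₂ ≤ d₁ + d₃`. -/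
def sub (d₁ d₂ d₃ : ℤ) (hd : d₂ ≤ d₁ + d₃) : LieSubalgebra ℂ AgeHat where
  toSubmodule := subSpan d₁ d₂ d₃
  lie_mem' := by
    intro x y hx hy
    change x ∈ Submodule.span ℂ _ at hx
    change y ∈ Submodule.span ℂ _ at hy
    change ⁅x, y⁆ ∈ subSpan d₁ d₂ d₃
    induction hx, hy using Submodule.span_induction₂ with
    | mem_mem x y hx hy => exact lie_mem_subSpan_of_subGen hd hx hy
    | zero_left y hy => simp
    | zero_right x hx => simp
    | add_left x y w hx hy hw h₁ h₂ =>
      rw [add_lie]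
      exact add_mem h₁ h₂
    | add_right x y w hx hy hw h₁ h₂ =>
      rw [lie_add]
      exact add_mem h₁ h₂
    | smul_left c x y hx hy h₁ =>
      rw [smul_lie]
      exact Submodule.smul_mem _ _ h₁
    | smul_right c x y hx hy h₁ =>
      rw [lie_smul]
      exact Submodule.smul_mem _ _ h₁

end AgeHat

/-! ### Induced modules -/

section Induced

variable {L : Type*} [LieRing L] [LieAlgebra ℂ L] (B : LieSubalgebra ℂ L)
  (V : Type*) [AddCommGroup V] [Module ℂ V] [LieRingModule B V] [LieModule ℂ B V]

attribute [local instance 100] LieRing.ofAssociativeRing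

/-- The algebra homomorphism `U(B) → U(L)` extending the inclusion `B ⊆ L`. -/
def envelopingIncl : UniversalEnvelopingAlgebra ℂ B →ₐ[ℂ] UniversalEnvelopingAlgebra ℂ L :=
  UniversalEnvelopingAlgebra.lift ℂ ((UniversalEnvelopingAlgebra.ι ℂ (L := L)).comp B.incl)

/-- The action of `U(B)` on the `B`-module `V`. -/
def envelopingAct : UniversalEnvelopingAlgebra ℂ B →ₐ[ℂ] Module.End ℂ V :=
  UniversalEnvelopingAlgebra.lift ℂ (LieModule.toEnd ℂ B V)

/-- The `U(L)`-submodule of `U(L) ⊗_ℂ V` generated by the elements `u b ⊗ v - u ⊗ b v` with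
`u ∈ U(L)`, `b ∈ U(B)` and `v ∈ V`. -/
def balancing : Submodule (UniversalEnvelopingAlgebra ℂ L)
    (UniversalEnvelopingAlgebra ℂ L ⊗[ℂ] V) :=
  Submodule.span _ {w | ∃ (u : UniversalEnvelopingAlgebra ℂ L)
    (b : UniversalEnvelopingAlgebra ℂ B) (v : V),
    w = (u * envelopingIncl B b) ⊗ₜ[ℂ] v - u ⊗ₜ[ℂ] envelopingAct B V b v}

/-- The induced module `U(L) ⊗_{U(B)} V`, the quotient of `U(L) ⊗_ℂ V` by the balancing
relations. -/
abbrev Ind : Type _ := (UniversalEnvelopingAlgebra ℂ L ⊗[ℂ] V) ⧸ balancing B V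

/-- `L` acts on `U(L) ⊗_{U(B)} V` by left multiplication through `L → U(L)`. -/
instance : LieRingModule L (Ind B V) where
  bracket x w := UniversalEnvelopingAlgebra.ι ℂ x • w
  add_lie x y w := by
    change UniversalEnvelopingAlgebra.ι ℂ (x + y) • w = _
    rw [map_add, add_smul]
  lie_add x w w' := smul_add _ w w'
  leibniz_lie x y w := by
    change UniversalEnvelopingAlgebra.ι ℂ x • UniversalEnvelopingAlgebra.ι ℂ y • w =
      UniversalEnvelopingAlgebra.ι ℂ ⁅x, y⁆ • w +
        UniversalEnvelopingAlgebra.ι ℂ y • UniversalEnvelopingAlgebra.ι ℂ x • w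
    rw [LieHom.map_lie, LieRing.of_associative_ring_bracket, sub_smul, mul_smul, mul_smul,
      sub_add_cancel]

theorem lie_ind_def (x : L) (w : Ind B V) : ⁅x, w⁆ = UniversalEnvelopingAlgebra.ι ℂ x • w := rfl

instance : LieModule ℂ L (Ind B V) where
  smul_lie c x w := by
    rw [lie_ind_def, lie_ind_def, map_smul, smul_assoc]
  lie_smul c x w := by
    rw [lie_ind_def, lie_ind_def, smul_comm]

/-- `x` belongs to `B` and acts injectively on the `B`-module `V`. -/
def ActsInjectively (x : L) : Prop :=
  ∃ hx : x ∈ B, Function.Injective fun v : V => ⁅(⟨x, hx⟩ : B), v⁆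

/-- `x` belongs to `B` and `x V = 0`. -/
def ActsAsZero (x : L) : Prop :=
  ∃ hx : x ∈ B, ∀ v : V, ⁅(⟨x, hx⟩ : B), v⁆ = 0

end Induced

namespace AgeHat

/-- The hypotheses on a module `V` over the subalgebra with parameters `(d₁, d₂, d₃)`: there is
an integer `l > d₂` such that `p_l` acts injectively on `V` and
`p_{l+i} V = z_{l+d₂-d₁+i-1} V = e_{l-d₃+i} V = q_{l-d₁+i} V = h_{l-d₂+i} V = 0` for all `i ≥ 1`. -/
def InductionConditions (d₁ d₂ d₃ : ℤ) (hd : d₂ ≤ d₁ + d₃) (V : Type*) [AddCommGroup V]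
    [Module ℂ V] [LieRingModule (sub d₁ d₂ d₃ hd) V] [LieModule ℂ (sub d₁ d₂ d₃ hd) V] : Prop :=
  ∃ l : ℤ, d₂ < l ∧ ActsInjectively (sub d₁ d₂ d₃ hd) V (p l) ∧
    ∀ i : ℤ, 0 < i →
      ActsAsZero (sub d₁ d₂ d₃ hd) V (p (l + i)) ∧
      ActsAsZero (sub d₁ d₂ d₃ hd) V (z (l + d₂ - d₁ + i - 1)) ∧
      ActsAsZero (sub d₁ d₂ d₃ hd) V (e (l - d₃ + i)) ∧
      ActsAsZero (sub d₁ d₂ d₃ hd) V (q (l - d₁ + i)) ∧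
      ActsAsZero (sub d₁ d₂ d₃ hd) V (h (l - d₂ + i))

section Restricted

variable (S : Type*) [AddCommGroup S] [Module ℂ S] [LieRingModule AgeHat S] [LieModule ℂ AgeHat S]

/-- A module is restricted if every vector is annihilated by `e_m, p_m, q_m, h_m, z_m` for all
sufficiently large `m`. -/
def IsRestricted : Prop :=
  ∀ w : S, ∃ M : ℤ, ∀ m : ℤ, M ≤ m →
    ⁅e m, w⁆ = 0 ∧ ⁅p m, w⁆ = 0 ∧ ⁅q m, w⁆ = 0 ∧ ⁅h m, w⁆ = 0 ∧ ⁅z m, w⁆ = 0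

/-- The subspace `N_{x₁,x₂,x₃,x₄}` of the vectors `v` with
`p_{x₁+i} v = e_{x₂+i} v = h_{x₃+i} v = q_{x₄+i} v = 0` for all `i ≥ 1`. -/
def N (x₁ x₂ x₃ x₄ : ℤ) : Submodule ℂ S where
  carrier := {v | ∀ i : ℤ, 0 < i →
    ⁅p (x₁ + i), v⁆ = 0 ∧ ⁅e (x₂ + i), v⁆ = 0 ∧ ⁅h (x₃ + i), v⁆ = 0 ∧ ⁅q (x₄ + i), v⁆ = 0}
  add_mem' := by
    intro v w hv hw i hi
    obtain ⟨h₁, h₂, h₃, h₄⟩ := hv i hi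
    obtain ⟨k₁, k₂, k₃, k₄⟩ := hw i hi
    simp [h₁, h₂, h₃, h₄, k₁, k₂, k₃, k₄]
  zero_mem' := by
    intro i hi
    simp
  smul_mem' := by
    intro c v hv i hi
    obtain ⟨h₁, h₂, h₃, h₄⟩ := hv i hi
    simp [h₁, h₂, h₃, h₄]

end Restricted

end AgeHat

end

/-!
Let `V = N_{l, l', l - d₂, l - d₁}` with `d₃ = l - l'`, `d₁ - d₂ = l - r` and `d₂` very negative.
The inequality `r ≤ 2l - l'` is exactly `d₂ ≤ d₁ + d₃`; a direct check (`AgeHat.lie_mem_N`) shows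
that `V` is stable under the subalgebra with parameters `(d₁, d₂, d₃)`, and it is nonzero since
`d₂` is small. Minimality of `l` makes `p_l` injective on `V` (`AgeHat.eq_zero_of_lie_p_eq_zero`).

The basis vectors outside the subalgebra, `h_{-j}`, `e_{d₁-j}`, `p_{d₂-j}`, `q_{d₃-j}` with `j ≥ 1`,
are paired by the bracket with `p_{l+j}`, `q_{l-d₁+j}`, `h_{l-d₂+j}`, `e_{l-d₃+j}`, which annihilate
`V`; up to sign, the bracket of a pair is `p_l`. Give the former the weights `2j+3`, `2j+2`, `2j+1`,
`2j+2`, give their partners the opposite degrees, and give all basis vectors in between degree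
zero. Then any other bracket between a raising element (of the first family) and a lowering
element (a partner) has smaller degree than the sum of the two degrees, and so has the bracket of
two raising elements. Hence, on the associated graded module, the raising elements act as commuting
variables and each partner acts as `p_l` times the corresponding partial derivative, up to sign
(`DualPairs.Compatible.lie_y_word`, where the sign is absorbed in the partner). An iterated
derivative isolates the coefficient of a monomial of maximal weight
(`DualPairs.Compatible.exists_coeff`), so injectivity of `p_l` on `V` makes distinct monomials act
independently on `V` inside `S` (`DualPairs.Compatible.eval_injective`).

On the other hand monomials applied to the image of `V` always span a submodule
(`DualPairs.Compatible.lie_mem_range_eval`), hence all of `S` and all of `Ind V`. The map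
`Ind V → S` sends monomials to monomials, so it is bijective (`DualPairs.nonempty_equiv_ind`);
linear independence of monomials in `Ind V` is not needed for this. If `W ⊆ V` is a nonzero
submodule, then `v ∈ V` is also a combination of monomials with coefficients in `W`, and uniqueness
gives `v ∈ W` (`DualPairs.isIrreducible_of_compatible`).
-/

noncomputable section

/-! ### Filtered Lie algebras with dual pairs of elements -/

/-- A filtration `D` of a Lie algebra `L` together with raising elements `x i` of positive weight
`wt i` and lowering elements `y i` of degree `-wt i`, which pair off in the associated graded
algebra: the `x i` commute up to lower order, and `⁅y i, x j⁆` is of lower order than expected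
except that `⁅y i, x i⁆ = c`, where `c` has degree zero and commutes with every `x i` up to lower
order. Monotonicity of `D` is not required. -/
structure DualPairs (L : Type*) [LieRing L] [LieAlgebra ℂ L] (ι : Type*) where
  /-- The filtration of `L`. -/
  D : ℤ → Submodule ℂ L
  /-- The raising elements. -/
  x : ι → L
  /-- The lowering elements. -/
  y : ι → L
  /-- The weights of the raising elements. -/
  wt : ι → ℤ
  /-- The common value of the brackets `⁅y i, x i⁆`. -/
  c : L
  wt_pos : ∀ i, 0 < wt i
  c_mem : c ∈ D 0
  y_mem : ∀ i, y i ∈ D (-wt i)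
  lie_x_mem : ∀ d, ∀ g ∈ D d, ∀ i, ⁅g, x i⁆ ∈ D (d + wt i)
  lie_x_x_mem : ∀ i j, ⁅x i, x j⁆ ∈ D (wt i + wt j - 1)
  lie_y_x_mem : ∀ i j, i ≠ j → ⁅y i, x j⁆ ∈ D (wt j - wt i - 1)
  lie_y_x_self : ∀ i, ⁅y i, x i⁆ = c
  lie_c_x_mem : ∀ i, ⁅c, x i⁆ ∈ D (wt i - 1)
  exhaustive : ∀ g, g ∈ ⨆ d, D d

namespace DualPairs

variable {L : Type*} [LieRing L] [LieAlgebra ℂ L] {ι : Type*} (T : DualPairs L ι)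
variable {M : Type*} [AddCommGroup M] [Module ℂ M] [LieRingModule L M] [LieModule ℂ L M]

/-- The operator by which the word `x i₁ ⋯ x iₙ` acts on a module. -/
def word (M : Type*) [AddCommGroup M] [Module ℂ M] [LieRingModule L M] [LieModule ℂ L M]
    (s : List ι) : Module.End ℂ M :=
  (s.map fun i => LieModule.toEnd ℂ L M (T.x i)).prod

@[simp] theorem word_nil (v : M) : T.word M [] v = v := rfl

@[simp] theorem word_cons (i : ι) (s : List ι) (v : M) :
    T.word M (i :: s) v = ⁅T.x i, T.word M s v⁆ := by
  simp [word]

/-- The total weight of a word. -/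
def weight (s : List ι) : ℤ := (s.map T.wt).sum

@[simp] theorem weight_nil : T.weight [] = 0 := rfl

@[simp] theorem weight_cons (i : ι) (s : List ι) :
    T.weight (i :: s) = T.wt i + T.weight s := by
  simp [weight]

theorem weight_nonneg (s : List ι) : 0 ≤ T.weight s := by
  induction s with
  | nil => simp
  | cons i s ih =>
    have := T.wt_pos i
    rw [weight_cons]
    omega

theorem weight_perm {s t : List ι} (h : s.Perm t) : T.weight s = T.weight t :=
  (h.map T.wt).sum_eq

/-- The span of the vectors obtained from `W` by words of weight at most `m`. -/
def filt (W : Submodule ℂ M) (m : ℤ) : Submodule ℂ M :=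
  Submodule.span ℂ {u | ∃ s : List ι, ∃ v ∈ W, T.weight s ≤ m ∧ u = T.word M s v}

variable {T} {W : Submodule ℂ M}

theorem word_mem_filt {s : List ι} {v : M} {m : ℤ} (hv : v ∈ W) (hs : T.weight s ≤ m) :
    T.word M s v ∈ T.filt W m :=
  Submodule.subset_span ⟨s, v, hv, hs, rfl⟩

theorem filt_mono {m n : ℤ} (h : m ≤ n) : T.filt W m ≤ T.filt W n :=
  Submodule.span_mono fun _ ⟨s, v, hv, hs, hu⟩ => ⟨s, v, hv, hs.trans h, hu⟩

theorem mem_filt_of_le {m n : ℤ} {u : M} (hu : u ∈ T.filt W m) (h : m ≤ n) : u ∈ T.filt W n :=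
  filt_mono h hu

theorem filt_of_neg {m : ℤ} (h : m < 0) : T.filt W m = ⊥ := by
  refine le_bot_iff.1 (Submodule.span_le.2 ?_)
  rintro _ ⟨s, v, -, hs, -⟩
  have := T.weight_nonneg s
  omega

theorem filt_zero : T.filt W 0 = W := by
  refine le_antisymm (Submodule.span_le.2 ?_) fun v hv => word_mem_filt (s := []) hv (by simp)
  rintro _ ⟨s, v, hv, hs, rfl⟩
  cases s with
  | nil => exact hv
  | cons i s =>
    have := T.weight_nonneg s
    have := T.wt_pos i
    rw [weight_cons] at hs
    omega

theorem lie_x_mem_filt {m : ℤ} {u : M} (hu : u ∈ T.filt W m) (i : ι) :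
    ⁅T.x i, u⁆ ∈ T.filt W (T.wt i + m) := by
  induction hu using Submodule.span_induction with
  | mem u hu =>
    obtain ⟨s, v, hv, hs, rfl⟩ := hu
    rw [← word_cons]
    exact word_mem_filt hv (by rw [weight_cons]; omega)
  | zero => simp
  | add u w _ _ hu hw => rw [lie_add]; exact add_mem hu hw
  | smul c u _ hu => rw [lie_smul]; exact Submodule.smul_mem _ _ hu

variable (T W) in
/-- The action of `L` on `W` is compatible with the filtrations. In particular elements of
negative degree annihilate `W` and elements of degree zero preserve it. -/
def Compatible : Prop := ∀ d, ∀ g ∈ T.D d, ∀ w ∈ W, ⁅g, w⁆ ∈ T.filt W d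

theorem Compatible.lie_mem_filt (hW : T.Compatible W) {d m : ℤ} {g : L} (hg : g ∈ T.D d) {u : M}
    (hu : u ∈ T.filt W m) : ⁅g, u⁆ ∈ T.filt W (d + m) := by
  have key : ∀ s : List ι, ∀ v ∈ W, ∀ d, ∀ g ∈ T.D d,
      ⁅g, T.word M s v⁆ ∈ T.filt W (d + T.weight s) := by
    intro s v hv
    induction s with
    | nil => intro d g hg; simpa using hW d g hg v hv
    | cons i s ih =>
      intro d g hg
      rw [word_cons, leibniz_lie, weight_cons]
      refine add_mem (mem_filt_of_le (ih _ _ (T.lie_x_mem d g hg i)) (by omega))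
        (mem_filt_of_le (lie_x_mem_filt (ih _ _ hg) i) (by omega))
  induction hu using Submodule.span_induction with
  | mem u hu =>
    obtain ⟨s, v, hv, hs, rfl⟩ := hu
    exact mem_filt_of_le (key s v hv d g hg) (by omega)
  | zero => simp
  | add u w _ _ hu hw => rw [lie_add]; exact add_mem hu hw
  | smul c u _ hu => rw [lie_smul]; exact Submodule.smul_mem _ _ hu

theorem Compatible.lie_c_mem (hW : T.Compatible W) {v : M} (hv : v ∈ W) : ⁅T.c, v⁆ ∈ W := by
  simpa [filt_zero] using hW 0 _ T.c_mem v hv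

theorem Compatible.word_perm (hW : T.Compatible W) {s t : List ι} (h : s.Perm t) {v : M}
    (hv : v ∈ W) : T.word M s v - T.word M t v ∈ T.filt W (T.weight s - 1) := by
  induction h with
  | nil => simp
  | cons i h ih =>
    rw [word_cons, word_cons, ← lie_sub, weight_cons]
    exact mem_filt_of_le (lie_x_mem_filt ih i) (by omega)
  | swap i j s =>
    simp only [word_cons, weight_cons]
    rw [leibniz_lie (T.x j), add_sub_cancel_right]
    exact mem_filt_of_le (hW.lie_mem_filt (T.lie_x_x_mem j i) (word_mem_filt hv le_rfl))
      (by omega)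
  | trans h₁ h₂ ih₁ ih₂ =>
    rw [← T.weight_perm h₁] at ih₂
    simpa using add_mem ih₁ ih₂

theorem Compatible.lie_c_word (hW : T.Compatible W) (s : List ι) {v : M} (hv : v ∈ W) :
    ⁅T.c, T.word M s v⁆ - T.word M s ⁅T.c, v⁆ ∈ T.filt W (T.weight s - 1) := by
  induction s with
  | nil => simp
  | cons i s ih =>
    rw [word_cons, word_cons, leibniz_lie, add_sub_assoc, ← lie_sub, weight_cons]
    exact add_mem (mem_filt_of_le (hW.lie_mem_filt (T.lie_c_x_mem i) (word_mem_filt hv le_rfl))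
      (by omega)) (mem_filt_of_le (lie_x_mem_filt ih i) (by omega))

open Classical in
/-- To leading order, `y i` acts on words as `c` times the partial derivative along `x i`. -/
theorem Compatible.lie_y_word (hW : T.Compatible W) (i : ι) (s : List ι) {v : M} (hv : v ∈ W) :
    ⁅T.y i, T.word M s v⁆ - (s.count i : ℂ) • T.word M (s.erase i) ⁅T.c, v⁆ ∈
      T.filt W (T.weight s - T.wt i - 1) := by
  have hi := T.wt_pos i
  induction s with
  | nil =>
    -- Both `-wt i` and `-wt i - 1` are negative, so the two filtration steps vanish.
    have := hW _ _ (T.y_mem i) v hv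
    rw [filt_of_neg (by omega), Submodule.mem_bot] at this
    simp [this]
  | cons j s ih =>
    rw [word_cons, leibniz_lie, weight_cons]
    have ih' := lie_x_mem_filt ih j
    rw [lie_sub, lie_smul] at ih'
    by_cases hij : i = j
    · subst hij
      rw [T.lie_y_x_self, List.erase_cons_head, List.count_cons_self]
      have h₁ := hW.lie_c_word s hv
      -- For `i ∉ s` the derivative of `s` vanishes; otherwise putting `x i` back in front of
      -- `s.erase i` is a permutation of `s`.
      have h₂ : (s.count i : ℂ) • ⁅T.x i, T.word M (s.erase i) ⁅T.c, v⁆⁆ -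
          (s.count i : ℂ) • T.word M s ⁅T.c, v⁆ ∈ T.filt W (T.weight s - 1) := by
        by_cases his : i ∈ s
        · have hp := List.perm_cons_erase his
          rw [← smul_sub, ← word_cons, T.weight_perm hp]
          exact Submodule.smul_mem _ _ (hW.word_perm hp.symm (hW.lie_c_mem hv))
        · simp [List.count_eq_zero_of_not_mem his]
      have h₃ := add_mem (add_mem (mem_filt_of_le h₁ (n := T.wt i + T.weight s - T.wt i - 1)
        (by omega)) (mem_filt_of_le h₂ (n := T.wt i + T.weight s - T.wt i - 1) (by omega)))
        (mem_filt_of_le ih' (n := T.wt i + T.weight s - T.wt i - 1) (by omega))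
      convert h₃ using 1
      push_cast
      rw [add_smul, one_smul]
      abel
    · rw [List.erase_cons_tail (by simpa using Ne.symm hij), word_cons,
        List.count_cons_of_ne (Ne.symm hij), add_sub_assoc ⁅⁅T.y i, T.x j⁆, T.word M s v⁆]
      have h₁ := hW.lie_mem_filt (T.lie_y_x_mem i j hij) (word_mem_filt (s := s) hv le_rfl)
      exact add_mem (mem_filt_of_le h₁ (by omega)) (mem_filt_of_le ih' (by omega))

open Classical in
/-- The product of the `y i` along a word `A` detects `A` among the words of at most the same
weight: it is an iterated partial derivative. -/
theorem Compatible.exists_coeff (hW : T.Compatible W) (A : List ι) :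
    ∃ Y : Module.End ℂ M, (∀ m < T.weight A, ∀ u ∈ T.filt W m, Y u = 0) ∧
      ∃ n : ℂ, n ≠ 0 ∧ ∀ B : List ι, T.weight B ≤ T.weight A → ∀ v ∈ W,
        Y (T.word M B v) =
          if B.Perm A then n • ((LieModule.toEnd ℂ L M T.c) ^ A.length) v else 0 := by
  induction A with
  | nil =>
    refine ⟨1, fun m hm u hu => ?_, 1, one_ne_zero, fun B hB v hv => ?_⟩
    · rw [filt_of_neg (by simpa using hm)] at hu
      simpa using hu
    · cases B with
      | nil => simp
      | cons i B =>
        have := T.weight_nonneg B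
        have := T.wt_pos i
        simp only [weight_cons, weight_nil] at hB
        omega
  | cons i A ih =>
    obtain ⟨Y, hY, n, hn, hB⟩ := ih
    refine ⟨Y * LieModule.toEnd ℂ L M (T.y i), fun m hm u hu => ?_,
      ((i :: A).count i : ℂ) * n, mul_ne_zero (by simpa using Nat.cast_add_one_ne_zero _) hn,
      fun B hBA v hv => ?_⟩
    · rw [weight_cons] at hm
      exact hY _ (by omega) _ (hW.lie_mem_filt (T.y_mem i) hu)
    · rw [weight_cons] at hBA
      have h₁ := hY _ (by omega) _ (hW.lie_y_word i B hv)
      rw [map_sub, map_smul, sub_eq_zero] at h₁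
      rw [Module.End.mul_apply, LieModule.toEnd_apply_apply, h₁]
      by_cases hiB : i ∈ B
      · have hp := List.perm_cons_erase hiB
        have hw := T.weight_perm hp
        rw [weight_cons] at hw
        rw [hB _ (by omega) _ (hW.lie_c_mem hv)]
        by_cases hBp : B.Perm (i :: A)
        · rw [if_pos hBp, if_pos ((List.perm_cons i).1 (hp.symm.trans hBp)), hBp.count_eq,
            List.length_cons, pow_succ, mul_smul]
          rfl
        · rw [if_neg hBp, if_neg fun h => hBp (hp.trans (h.cons i)), smul_zero]
      · rw [if_neg fun h => hiB (h.mem_iff.2 List.mem_cons_self),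
          List.count_eq_zero_of_not_mem hiB]
        simp

variable (T) in
/-- The map sending a formal combination of monomials in the `x i` with coefficients in `V` to
its value in `M`, where `V` is mapped to `M` by `j`. Each monomial is a multiset, and its factors
are multiplied in an arbitrary but fixed order. -/
def eval {V : Type*} [AddCommGroup V] [Module ℂ V] (j : V →ₗ[ℂ] M) :
    (Multiset ι →₀ V) →ₗ[ℂ] M :=
  Finsupp.lsum ℂ fun a => T.word M a.toList ∘ₗ j

theorem eval_single {V : Type*} [AddCommGroup V] [Module ℂ V] (j : V →ₗ[ℂ] M) (a : Multiset ι)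
    (v : V) : T.eval j (Finsupp.single a v) = T.word M a.toList (j v) := by
  simp [eval]

theorem map_eval {M' : Type*} [AddCommGroup M'] [Module ℂ M'] [LieRingModule L M']
    [LieModule ℂ L M'] {V : Type*} [AddCommGroup V] [Module ℂ V] (j : V →ₗ[ℂ] M)
    (φ : M →ₗ⁅ℂ, L⁆ M') (f : Multiset ι →₀ V) :
    φ (T.eval j f) = T.eval ((φ : M →ₗ[ℂ] M') ∘ₗ j) f := by
  have hword : ∀ (s : List ι) (u : M), φ (T.word M s u) = T.word M' s (φ u) := by
    intro s u
    induction s with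
    | nil => simp
    | cons i s ih => rw [word_cons, word_cons, LieModuleHom.map_lie, ih]
  induction f using Finsupp.induction_linear with
  | zero => simp
  | add f g hf hg => rw [map_add, map_add, map_add, hf, hg]
  | single a v => simp [eval_single, hword]

/-- Distinct monomials act independently on `j V`, as soon as `c` is injective there. -/
theorem Compatible.eval_injective {V : Type*} [AddCommGroup V] [Module ℂ V] {j : V →ₗ[ℂ] M}
    (hW : T.Compatible (LinearMap.range j)) (hj : Function.Injective j)
    (hc : ∀ v, ⁅T.c, j v⁆ = 0 → v = 0) : Function.Injective (T.eval j) := by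
  classical
  rw [injective_iff_map_eq_zero]
  intro f hf
  by_contra hne
  -- The operator detecting a monomial of maximal weight in `f` isolates its coefficient.
  obtain ⟨a, ha, hmax⟩ := f.support.exists_max_image (fun a => T.weight a.toList)
    (Finsupp.support_nonempty_iff.2 hne)
  obtain ⟨Y, -, n, hn, hY⟩ := hW.exists_coeff a.toList
  have h₁ : Y (T.eval j f) =
      n • ((LieModule.toEnd ℂ L M T.c) ^ a.toList.length) (j (f a)) := by
    rw [eval, Finsupp.lsum_apply, Finsupp.sum, map_sum, Finset.sum_eq_single a]
    · exact (hY _ le_rfl _ ⟨_, rfl⟩).trans (if_pos (List.Perm.refl _))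
    · intro b hb hba
      refine (hY _ (hmax b hb) _ ⟨_, rfl⟩).trans (if_neg fun h => hba ?_)
      simpa using Multiset.coe_eq_coe.2 h
    · exact fun h => absurd ha h
  have h₂ : ∀ k : ℕ, ∀ v, ((LieModule.toEnd ℂ L M T.c) ^ k) (j v) = 0 → v = 0 := by
    intro k
    induction k with
    | zero => exact fun v h => hj (by simpa using h)
    | succ k ih =>
      intro v h
      obtain ⟨w, hw⟩ := hW.lie_c_mem ⟨v, rfl⟩
      rw [pow_succ, Module.End.mul_apply, LieModule.toEnd_apply_apply, ← hw] at h
      exact hc v (by rw [← hw, ih w h, map_zero])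
  rw [hf, map_zero] at h₁
  exact Finsupp.mem_support_iff.1 ha (h₂ _ _ ((smul_eq_zero.1 h₁.symm).resolve_left hn))

/-- Reordering a word changes it by terms of lower weight, so ordered monomials suffice. -/
theorem Compatible.filt_le_range_eval {V : Type*} [AddCommGroup V] [Module ℂ V] {j : V →ₗ[ℂ] M}
    (hW : T.Compatible (LinearMap.range j)) (m : ℤ) :
    T.filt (LinearMap.range j) m ≤ LinearMap.range (T.eval j) := by
  suffices h : ∀ n : ℕ, T.filt (LinearMap.range j) ((n : ℤ) - 1) ≤ LinearMap.range (T.eval j) from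
    (filt_mono (by omega)).trans (h (m + 1).toNat)
  intro n
  induction n with
  | zero => rw [filt_of_neg (by simp)]; exact bot_le
  | succ n ih =>
    refine Submodule.span_le.2 ?_
    rintro _ ⟨s, _, ⟨v, rfl⟩, hs, rfl⟩
    have hp : s.Perm (s : Multiset ι).toList := Multiset.coe_eq_coe.1 (by simp)
    have h₁ := ih (mem_filt_of_le (hW.word_perm hp ⟨v, rfl⟩)
      (by push_cast at hs; omega))
    have h₂ : T.word M (s : Multiset ι).toList (j v) ∈ LinearMap.range (T.eval j) :=
      ⟨Finsupp.single s v, eval_single ..⟩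
    simpa using add_mem h₁ h₂

theorem Compatible.lie_mem_iSup_filt (hW : T.Compatible W) (g : L) {u : M}
    (hu : u ∈ ⨆ m, T.filt W m) : ⁅g, u⁆ ∈ ⨆ m, T.filt W m := by
  have hle : ∀ m, T.filt W m ≤ ⨆ m, T.filt W m := fun m => le_iSup (T.filt W) m
  induction hu using Submodule.iSup_induction' with
  | mem m u hu =>
    induction T.exhaustive g using Submodule.iSup_induction' with
    | mem d g hg => exact hle _ (hW.lie_mem_filt hg hu)
    | zero => simp
    | add g₁ g₂ _ _ h₁ h₂ => rw [add_lie]; exact add_mem h₁ h₂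
  | zero => simp
  | add u w _ _ hu hw => rw [lie_add]; exact add_mem hu hw

/-- The monomials in the `x i` applied to `j V` span an `L`-submodule of `M`: this is the easy half
of the Poincaré–Birkhoff–Witt theorem for induced modules. -/
theorem Compatible.lie_mem_range_eval {V : Type*} [AddCommGroup V] [Module ℂ V] {j : V →ₗ[ℂ] M}
    (hW : T.Compatible (LinearMap.range j)) (g : L) {u : M} (hu : u ∈ LinearMap.range (T.eval j)) :
    ⁅g, u⁆ ∈ LinearMap.range (T.eval j) := by
  have h : LinearMap.range (T.eval j) = ⨆ m, T.filt (LinearMap.range j) m := by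
    refine le_antisymm ?_ (iSup_le fun m => hW.filt_le_range_eval m)
    rintro _ ⟨f, rfl⟩
    rw [eval, Finsupp.lsum_apply]
    exact Submodule.sum_mem _ fun a _ => le_iSup (T.filt (LinearMap.range j)) _
      (word_mem_filt ⟨f a, rfl⟩ le_rfl)
  rw [h] at hu ⊢
  exact hW.lie_mem_iSup_filt g hu

end DualPairs

/-! ### Brackets and basis of `AgeHat` -/

namespace AgeHat

theorem lie_e_h (m n : ℤ) : ⁅e m, h n⁆ = -((2 : ℂ) • e (m + n)) := by
  rw [← lie_skew, lie_h_e, add_comm]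

theorem lie_p_h (m n : ℤ) : ⁅p m, h n⁆ = -p (m + n) := by
  rw [← lie_skew, lie_h_p, add_comm]

theorem lie_q_h (m n : ℤ) : ⁅q m, h n⁆ = q (m + n) := by
  rw [← lie_skew, lie_h_q, add_comm, neg_neg]

theorem lie_p_e (m n : ℤ) : ⁅p m, e n⁆ = 0 := by
  rw [← lie_skew, lie_e_p, neg_zero]

theorem lie_q_e (m n : ℤ) : ⁅q m, e n⁆ = -p (m + n) := by
  rw [← lie_skew, lie_e_q, add_comm]

theorem lie_q_p (m n : ℤ) : ⁅q m, p n⁆ = -z (m + n) := by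
  rw [← lie_skew, lie_p_q, add_comm]

theorem k_lie (x : AgeHat) : ⁅k, x⁆ = 0 := by
  rw [← lie_skew, bracket_k, neg_zero]

/-- `AgeHat` is spanned by the elements `h_n, e_n, p_n, q_n, z_n` and `k`. -/
theorem mem_of_basis_mem (P : Submodule ℂ AgeHat) (hh : ∀ n, h n ∈ P) (he : ∀ n, e n ∈ P)
    (hp : ∀ n, p n ∈ P) (hq : ∀ n, q n ∈ P) (hz : ∀ n, z n ∈ P) (hk : k ∈ P) (g : AgeHat) :
    g ∈ P := by
  have hgen : ∀ (α : Age) (n : ℤ), gen α n ∈ P := by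
    intro α n
    have hα : α = α 0 • Age.e + α 1 • Age.h + α 2 • Age.p + α 3 • Age.q + α 4 • Age.z := by
      ext i
      fin_cases i <;> simp <;> simp [Age.e, Age.h, Age.p, Age.q, Age.z]
    have hadd : ∀ β γ : Age, gen (β + γ) n = gen β n + gen γ n := by
      intro β γ
      simp [gen, ← LieAlgebra.of_add, TensorProduct.tmul_add]
    rw [hα]
    simp only [hadd, gen_smul]
    exact add_mem (add_mem (add_mem (add_mem (P.smul_mem _ (he n)) (P.smul_mem _ (hh n)))
      (P.smul_mem _ (hp n))) (P.smul_mem _ (hq n))) (P.smul_mem _ (hz n))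
  have hloop : ∀ t : LieAlgebra.loopAlgebra ℂ ℤ Age, LieAlgebra.ofProd ageCocycle (t, 0) ∈ P := by
    intro t
    induction t using TensorProduct.induction_on with
    | zero => exact P.zero_mem
    | tmul f α =>
      induction f using AddMonoidAlgebra.induction_linear with
      | zero => rw [TensorProduct.zero_tmul]; exact P.zero_mem
      | add f g hf hg =>
        rw [TensorProduct.add_tmul]
        simpa [← LieAlgebra.of_add] using add_mem hf hg
      | single n c =>
        have := P.smul_mem c (hgen α n)
        rw [gen, ← LieAlgebra.of_smul] at this
        rwa [Prod.smul_mk, smul_zero, TensorProduct.smul_tmul', AddMonoidAlgebra.smul_single,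
          smul_eq_mul, mul_one] at this
    | add f g hf hg => simpa [← LieAlgebra.of_add] using add_mem hf hg
  obtain ⟨⟨t, c⟩, rfl⟩ := (LieAlgebra.ofProd ageCocycle).surjective g
  have hc := P.smul_mem (TrivialLieModule.equiv ℂ (LieAlgebra.loopAlgebra ℂ ℤ Age) ℂ c) hk
  rw [k, ← LieAlgebra.of_smul] at hc
  have := add_mem (hloop t) hc
  rw [← LieAlgebra.of_add] at this
  convert this using 2
  simp [← map_smul]

/-! ### The degree filtration of `AgeHat` -/

/-- The degree of the `n`-th member of a family whose members with `lo ≤ n ≤ hi` have degree zero: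
it is `2 (lo - n) + a` below this range and `-(2 (n - hi) + b)` above it. -/
def stepDeg (lo hi a b n : ℤ) : ℤ :=
  if n < lo then 2 * (lo - n) + a else if n ≤ hi then 0 else -(2 * (n - hi) + b)

/-- The basis vectors of degree at most `d`. The elements `z_n` with `n ≥ l + d₂ - d₁` count as
having degree `-∞`, as they annihilate the modules considered here. -/
inductive DegLE (d₁ d₂ d₃ l d : ℤ) : AgeHat → Prop
  | h (n : ℤ) (hn : stepDeg 0 (l - d₂) 3 1 n ≤ d) : DegLE d₁ d₂ d₃ l d (h n)
  | e (n : ℤ) (hn : stepDeg d₁ (l - d₃) 2 2 n ≤ d) : DegLE d₁ d₂ d₃ l d (e n)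
  | p (n : ℤ) (hn : stepDeg d₂ l 1 3 n ≤ d) : DegLE d₁ d₂ d₃ l d (p n)
  | q (n : ℤ) (hn : stepDeg d₃ (l - d₁) 2 2 n ≤ d) : DegLE d₁ d₂ d₃ l d (q n)
  | z (n : ℤ) (hn : n < l + d₂ - d₁ → 0 ≤ d) : DegLE d₁ d₂ d₃ l d (z n)
  | k (hd : 0 ≤ d) : DegLE d₁ d₂ d₃ l d k

/-- The filtration of `AgeHat` by degree. -/
def degFilt (d₁ d₂ d₃ l d : ℤ) : Submodule ℂ AgeHat :=
  Submodule.span ℂ {g | DegLE d₁ d₂ d₃ l d g}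

variable {d₁ d₂ d₃ l d : ℤ}

theorem h_mem_degFilt {n : ℤ} (hn : stepDeg 0 (l - d₂) 3 1 n ≤ d) :
    h n ∈ degFilt d₁ d₂ d₃ l d := Submodule.subset_span (.h n hn)

theorem e_mem_degFilt {n : ℤ} (hn : stepDeg d₁ (l - d₃) 2 2 n ≤ d) :
    e n ∈ degFilt d₁ d₂ d₃ l d := Submodule.subset_span (.e n hn)

theorem p_mem_degFilt {n : ℤ} (hn : stepDeg d₂ l 1 3 n ≤ d) :
    p n ∈ degFilt d₁ d₂ d₃ l d := Submodule.subset_span (.p n hn)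

theorem q_mem_degFilt {n : ℤ} (hn : stepDeg d₃ (l - d₁) 2 2 n ≤ d) :
    q n ∈ degFilt d₁ d₂ d₃ l d := Submodule.subset_span (.q n hn)

theorem z_mem_degFilt {n : ℤ} (hn : n < l + d₂ - d₁ → 0 ≤ d) :
    z n ∈ degFilt d₁ d₂ d₃ l d := Submodule.subset_span (.z n hn)

theorem k_mem_degFilt (hd : 0 ≤ d) : k ∈ degFilt d₁ d₂ d₃ l d := Submodule.subset_span (.k hd)

/-- Indices of the basis vectors of `AgeHat` outside the subalgebra `sub d₁ d₂ d₃`. -/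
inductive Idx : Type
  /-- The index of `h_{-(j+1)}`. -/
  | h (j : ℕ)
  /-- The index of `e_{d₁-(j+1)}`. -/
  | e (j : ℕ)
  /-- The index of `p_{d₂-(j+1)}`. -/
  | p (j : ℕ)
  /-- The index of `q_{d₃-(j+1)}`. -/
  | q (j : ℕ)

/-- The basis vectors of `AgeHat` outside the subalgebra `sub d₁ d₂ d₃`. -/
def raise (d₁ d₂ d₃ : ℤ) : Idx → AgeHat
  | .h j => h (-(j + 1))
  | .e j => e (d₁ - (j + 1))
  | .p j => p (d₂ - (j + 1))
  | .q j => q (d₃ - (j + 1))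

/-- The elements of the subalgebra `sub d₁ d₂ d₃` paired with `raise` by `⁅lower i, raise i⁆ = p l`;
they annihilate the inducing module. -/
def lower (d₁ d₂ d₃ l : ℤ) : Idx → AgeHat
  | .h j => -p (l + (j + 1))
  | .e j => -q (l - d₁ + (j + 1))
  | .p j => h (l - d₂ + (j + 1))
  | .q j => e (l - d₃ + (j + 1))

/-- The degrees of the elements `raise`. The slope `2` and the constants `3 > 2 > 1 > 0` are chosen
so that all the brackets in `lie_lower_raise_mem` drop the degree: constants decreasing from `h` to
`e, q` to `p` handle the brackets involving `h`, and consecutive differences below the slope handle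
`⁅p_m, q_n⁆ = z_{m+n}`, which is nonzero only when the shift is at least one step. -/
def raiseDeg : Idx → ℤ
  | .h j => 2 * (j + 1) + 3
  | .e j => 2 * (j + 1) + 2
  | .p j => 2 * (j + 1) + 1
  | .q j => 2 * (j + 1) + 2

theorem lie_lower_raise_self (i : Idx) : ⁅lower d₁ d₂ d₃ l i, raise d₁ d₂ d₃ i⁆ = p l := by
  cases i <;> simp only [lower, raise, neg_lie, lie_p_h, lie_q_e, lie_h_p, lie_e_q, neg_neg] <;>
    congr 1 <;> ring

/-- Bracketing with a raising element respects the filtration. -/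
theorem lie_raise_mem (hd : d₂ ≤ d₁ + d₃) (h₁ : d₂ + 5 ≤ l) (h₂ : d₁ + d₃ + 5 ≤ l)
    {g : AgeHat} (hg : g ∈ degFilt d₁ d₂ d₃ l d) (i : Idx) :
    ⁅g, raise d₁ d₂ d₃ i⁆ ∈ degFilt d₁ d₂ d₃ l (d + raiseDeg i) := by
  induction hg using Submodule.span_induction with
  | zero => simp
  | add u w _ _ hu hw => rw [add_lie]; exact add_mem hu hw
  | smul c u _ hu => rw [smul_lie]; exact Submodule.smul_mem _ _ hu
  | mem g hg =>
    cases hg with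
    | k hd => rw [k_lie]; exact zero_mem _
    | z n hn => cases i <;> exact (lie_z_gen ..).symm ▸ zero_mem _
    | h m hm =>
      cases i with
      | h j =>
        rw [raise, lie_h_h]
        split_ifs with hmj
        · refine Submodule.smul_mem _ _ (k_mem_degFilt ?_)
          simp only [stepDeg, raiseDeg] at hm ⊢
          split_ifs at hm <;> omega
        · rw [zero_smul]
          exact zero_mem _
      | e j =>
        rw [raise, lie_h_e]
        refine Submodule.smul_mem _ _ (e_mem_degFilt ?_)
        simp only [stepDeg, raiseDeg] at hm ⊢
        split_ifs at hm ⊢ <;> omega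
      | p j =>
        rw [raise, lie_h_p]
        refine p_mem_degFilt ?_
        simp only [stepDeg, raiseDeg] at hm ⊢
        split_ifs at hm ⊢ <;> omega
      | q j =>
        rw [raise, lie_h_q]
        refine neg_mem (q_mem_degFilt ?_)
        simp only [stepDeg, raiseDeg] at hm ⊢
        split_ifs at hm ⊢ <;> omega
    | e m hm =>
      cases i with
      | h j =>
        rw [raise, lie_e_h]
        refine neg_mem (Submodule.smul_mem _ _ (e_mem_degFilt ?_))
        simp only [stepDeg, raiseDeg] at hm ⊢
        split_ifs at hm ⊢ <;> omega
      | e j => rw [raise, lie_e_e]; exact zero_mem _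
      | p j => rw [raise, lie_e_p]; exact zero_mem _
      | q j =>
        rw [raise, lie_e_q]
        refine p_mem_degFilt ?_
        simp only [stepDeg, raiseDeg] at hm ⊢
        split_ifs at hm ⊢ <;> omega
    | p m hm =>
      cases i with
      | h j =>
        rw [raise, lie_p_h]
        refine neg_mem (p_mem_degFilt ?_)
        simp only [stepDeg, raiseDeg] at hm ⊢
        split_ifs at hm ⊢ <;> omega
      | e j => rw [raise, lie_p_e]; exact zero_mem _
      | p j => rw [raise, lie_p_p]; exact zero_mem _
      | q j =>
        rw [raise, lie_p_q]
        refine z_mem_degFilt ?_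
        simp only [stepDeg, raiseDeg] at hm ⊢
        split_ifs at hm <;> omega
    | q m hm =>
      cases i with
      | h j =>
        rw [raise, lie_q_h]
        refine q_mem_degFilt ?_
        simp only [stepDeg, raiseDeg] at hm ⊢
        split_ifs at hm ⊢ <;> omega
      | e j =>
        rw [raise, lie_q_e]
        refine neg_mem (p_mem_degFilt ?_)
        simp only [stepDeg, raiseDeg] at hm ⊢
        split_ifs at hm ⊢ <;> omega
      | p j =>
        rw [raise, lie_q_p]
        refine neg_mem (z_mem_degFilt ?_)
        simp only [stepDeg, raiseDeg] at hm ⊢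
        split_ifs at hm <;> omega
      | q j => rw [raise, lie_q_q]; exact zero_mem _

/-- Raising elements commute to leading order. -/
theorem lie_raise_raise_mem (hd : d₂ ≤ d₁ + d₃) (h₁ : d₂ + 5 ≤ l) (h₂ : d₁ + d₃ + 5 ≤ l)
    (i i' : Idx) :
    ⁅raise d₁ d₂ d₃ i, raise d₁ d₂ d₃ i'⁆ ∈ degFilt d₁ d₂ d₃ l (raiseDeg i + raiseDeg i' - 1) := by
  cases i <;> cases i' <;>
    simp only [raise, lie_h_h, lie_h_e, lie_h_p, lie_h_q, lie_e_h, lie_e_e, lie_e_p, lie_e_q,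
      lie_p_h, lie_p_e, lie_p_p, lie_p_q, lie_q_h, lie_q_e, lie_q_p, lie_q_q, neg_mem_iff,
      zero_mem] <;>
    (first
      | refine Submodule.smul_mem _ _ (k_mem_degFilt ?_)
      | refine Submodule.smul_mem _ _ (e_mem_degFilt ?_)
      | refine p_mem_degFilt ?_
      | refine q_mem_degFilt ?_
      | refine z_mem_degFilt ?_) <;>
    simp only [stepDeg, raiseDeg] <;> (try split_ifs) <;> omega

/-- Raising and lowering elements with different indices commute to leading order. -/
theorem lie_lower_raise_mem (hd : d₂ ≤ d₁ + d₃) (h₁ : d₂ + 5 ≤ l) (h₂ : d₁ + d₃ + 5 ≤ l)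
    {i i' : Idx} (hi : i ≠ i') :
    ⁅lower d₁ d₂ d₃ l i, raise d₁ d₂ d₃ i'⁆ ∈
      degFilt d₁ d₂ d₃ l (raiseDeg i' - raiseDeg i - 1) := by
  cases i <;> cases i' <;>
    simp only [lower, raise, neg_lie, lie_h_h, lie_h_e, lie_h_p, lie_h_q, lie_e_h, lie_e_e,
      lie_e_p, lie_e_q, lie_p_h, lie_p_e, lie_p_p, lie_p_q, lie_q_h, lie_q_e, lie_q_p, lie_q_q,
      neg_mem_iff, zero_mem] <;>
    simp only [ne_eq, Idx.h.injEq, Idx.e.injEq, Idx.p.injEq, Idx.q.injEq] at hi <;>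
    (first
      | refine Submodule.smul_mem _ _ (e_mem_degFilt ?_)
      | refine p_mem_degFilt ?_
      | refine q_mem_degFilt ?_
      | refine z_mem_degFilt ?_
      | skip) <;>
    simp only [stepDeg, raiseDeg] <;> (try split_ifs) <;> try omega
  -- What remains is `⁅h_m, h_n⁆`, whose central term occurs only for `m + n = 0`.
  · exact Submodule.smul_mem _ _ (k_mem_degFilt (by omega))
  · rw [zero_smul]
    exact zero_mem _

theorem lie_p_raise_mem (h₁ : d₂ + 5 ≤ l) (i : Idx) :
    ⁅p l, raise d₁ d₂ d₃ i⁆ ∈ degFilt d₁ d₂ d₃ l (raiseDeg i - 1) := by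
  cases i <;>
    simp only [raise, lie_p_h, lie_p_e, lie_p_p, lie_p_q, neg_mem_iff, zero_mem] <;>
    (first
      | refine p_mem_degFilt ?_
      | refine z_mem_degFilt ?_) <;>
    simp only [stepDeg, raiseDeg] <;> (try split_ifs) <;> omega

/-- The degree filtration of `AgeHat` with its raising and lowering elements. The two gap
hypotheses make the ranges of degree zero long enough for the brackets leaving such a range on
the far side to have lower order. -/
def dualPairs (hd : d₂ ≤ d₁ + d₃) (h₁ : d₂ + 5 ≤ l) (h₂ : d₁ + d₃ + 5 ≤ l) :
    DualPairs AgeHat Idx where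
  D := degFilt d₁ d₂ d₃ l
  x := raise d₁ d₂ d₃
  y := lower d₁ d₂ d₃ l
  wt := raiseDeg
  c := p l
  wt_pos i := by cases i <;> simp only [raiseDeg] <;> omega
  c_mem := p_mem_degFilt (by simp only [stepDeg]; split_ifs <;> omega)
  y_mem i := by
    cases i <;> simp only [lower, neg_mem_iff] <;>
      (first
        | refine h_mem_degFilt ?_
        | refine e_mem_degFilt ?_
        | refine p_mem_degFilt ?_
        | refine q_mem_degFilt ?_) <;>
      simp only [stepDeg, raiseDeg] <;> split_ifs <;> omega
  lie_x_mem _ _ hg i := lie_raise_mem hd h₁ h₂ hg i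
  lie_x_x_mem := lie_raise_raise_mem hd h₁ h₂
  lie_y_x_mem _ _ hi := lie_lower_raise_mem hd h₁ h₂ hi
  lie_y_x_self := lie_lower_raise_self
  lie_c_x_mem := lie_p_raise_mem h₁
  exhaustive := by
    have hle : ∀ d, degFilt d₁ d₂ d₃ l d ≤ ⨆ d, degFilt d₁ d₂ d₃ l d := le_iSup _
    exact mem_of_basis_mem _ (fun n => hle _ (h_mem_degFilt le_rfl))
      (fun n => hle _ (e_mem_degFilt le_rfl)) (fun n => hle _ (p_mem_degFilt le_rfl))
      (fun n => hle _ (q_mem_degFilt le_rfl)) (fun n => hle 0 (z_mem_degFilt fun _ => le_rfl))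
      (hle 0 (k_mem_degFilt le_rfl))

variable {M : Type*} [AddCommGroup M] [Module ℂ M] [LieRingModule AgeHat M] [LieModule ℂ AgeHat M]

/-- Compatibility with the degree filtration says that `W` is stable under the subalgebra, and is
annihilated by the lowering elements and by the `z_n` of degree `-∞`. -/
theorem compatible_dualPairs (hd : d₂ ≤ d₁ + d₃) (h₁ : d₂ + 5 ≤ l) (h₂ : d₁ + d₃ + 5 ≤ l)
    {W : Submodule ℂ M} (hB : ∀ b ∈ subSpan d₁ d₂ d₃, ∀ w ∈ W, ⁅b, w⁆ ∈ W)
    (hann : ∀ i : ℤ, 0 < i → ∀ w ∈ W, ⁅p (l + i), w⁆ = 0 ∧ ⁅z (l + d₂ - d₁ + i - 1), w⁆ = 0 ∧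
      ⁅e (l - d₃ + i), w⁆ = 0 ∧ ⁅q (l - d₁ + i), w⁆ = 0 ∧ ⁅h (l - d₂ + i), w⁆ = 0) :
    (dualPairs hd h₁ h₂).Compatible W := by
  set T := dualPairs hd h₁ h₂
  have hsub : ∀ {b : AgeHat} {d : ℤ}, b ∈ subSpan d₁ d₂ d₃ → 0 ≤ d → ∀ w ∈ W,
      ⁅b, w⁆ ∈ T.filt W d := fun hb hd w hw =>
    DualPairs.filt_mono hd ((DualPairs.filt_zero (T := T) (W := W)).symm ▸ hB _ hb w hw)
  have hraise : ∀ (i : Idx) {d : ℤ}, raiseDeg i ≤ d → ∀ w ∈ W,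
      ⁅raise d₁ d₂ d₃ i, w⁆ ∈ T.filt W d := by
    intro i d hi w hw
    have hi' : T.weight [i] ≤ d := by
      rw [DualPairs.weight_cons, DualPairs.weight_nil, add_zero]
      exact hi
    have := DualPairs.word_mem_filt hw hi'
    rwa [DualPairs.word_cons, DualPairs.word_nil] at this
  intro d g hg w hw
  change g ∈ degFilt d₁ d₂ d₃ l d at hg
  induction hg using Submodule.span_induction with
  | zero => simp
  | add u v _ _ hu hv => rw [add_lie]; exact add_mem hu hv
  | smul c u _ hu => rw [smul_lie]; exact Submodule.smul_mem _ _ hu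
  | mem g hg =>
    cases hg with
    | k hd => exact hsub k_mem hd w hw
    | z n hn =>
      by_cases hlt : n < l + d₂ - d₁
      · exact hsub (z_mem n) (hn hlt) w hw
      · have := (hann (n - (l + d₂ - d₁) + 1) (by omega) w hw).2.1
        rw [show l + d₂ - d₁ + (n - (l + d₂ - d₁) + 1) - 1 = n by ring] at this
        simp [this]
    | h n hn =>
      rw [stepDeg] at hn
      split_ifs at hn with ha hb
      · obtain ⟨j, hj⟩ := Int.eq_ofNat_of_zero_le (show 0 ≤ -n - 1 by omega)
        obtain rfl : n = -(j + 1) := by omega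
        exact hraise (.h j) (by simp only [raiseDeg]; omega) w hw
      · exact hsub (h_mem (by omega)) hn w hw
      · have := (hann (n - (l - d₂)) (by omega) w hw).2.2.2.2
        rw [add_sub_cancel] at this
        simp [this]
    | e n hn =>
      rw [stepDeg] at hn
      split_ifs at hn with ha hb
      · obtain ⟨j, hj⟩ := Int.eq_ofNat_of_zero_le (show 0 ≤ d₁ - n - 1 by omega)
        obtain rfl : n = d₁ - (j + 1) := by omega
        exact hraise (.e j) (by simp only [raiseDeg]; omega) w hw
      · exact hsub (e_mem (by omega)) hn w hw
      · have := (hann (n - (l - d₃)) (by omega) w hw).2.2.1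
        rw [add_sub_cancel] at this
        simp [this]
    | p n hn =>
      rw [stepDeg] at hn
      split_ifs at hn with ha hb
      · obtain ⟨j, hj⟩ := Int.eq_ofNat_of_zero_le (show 0 ≤ d₂ - n - 1 by omega)
        obtain rfl : n = d₂ - (j + 1) := by omega
        exact hraise (.p j) (by simp only [raiseDeg]; omega) w hw
      · exact hsub (p_mem (by omega)) hn w hw
      · have := (hann (n - l) (by omega) w hw).1
        rw [add_sub_cancel] at this
        simp [this]
    | q n hn =>
      rw [stepDeg] at hn
      split_ifs at hn with ha hb
      · obtain ⟨j, hj⟩ := Int.eq_ofNat_of_zero_le (show 0 ≤ d₃ - n - 1 by omega)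
        obtain rfl : n = d₃ - (j + 1) := by omega
        exact hraise (.q j) (by simp only [raiseDeg]; omega) w hw
      · exact hsub (q_mem (by omega)) hn w hw
      · have := (hann (n - (l - d₁)) (by omega) w hw).2.2.2.1
        rw [add_sub_cancel] at this
        simp [this]

end AgeHat

/-! ### The universal property of induced modules -/

section Induction

variable {L : Type*} [LieRing L] [LieAlgebra ℂ L]

attribute [local instance 100] LieRing.ofAssociativeRing

/-- A predicate on `U(L)` that holds on scalars and on `L` and is preserved by sums and products
holds everywhere. -/
theorem UniversalEnvelopingAlgebra.induction_on {P : UniversalEnvelopingAlgebra ℂ L → Prop}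
    (u : UniversalEnvelopingAlgebra ℂ L) (hr : ∀ r : ℂ, P (algebraMap ℂ _ r))
    (hι : ∀ x : L, P (UniversalEnvelopingAlgebra.ι ℂ x)) (hmul : ∀ a b, P a → P b → P (a * b))
    (hadd : ∀ a b, P a → P b → P (a + b)) : P u := by
  let A : Subalgebra ℂ (UniversalEnvelopingAlgebra ℂ L) :=
    { carrier := {u | P u}
      mul_mem' := fun ha hb => hmul _ _ ha hb
      add_mem' := fun ha hb => hadd _ _ ha hb
      algebraMap_mem' := hr }
  let F : L →ₗ⁅ℂ⁆ A :=
    { toFun := fun x => ⟨UniversalEnvelopingAlgebra.ι ℂ x, hι x⟩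
      map_add' := fun x y => Subtype.ext (map_add _ x y)
      map_smul' := fun c x => Subtype.ext (map_smul _ c x)
      map_lie' := fun {x y} => Subtype.ext (LieHom.map_lie _ x y) }
  have hF : A.val.comp (UniversalEnvelopingAlgebra.lift ℂ F) = AlgHom.id ℂ _ := by
    refine UniversalEnvelopingAlgebra.hom_ext ℂ (LieHom.ext fun x => ?_)
    change A.val (UniversalEnvelopingAlgebra.lift ℂ F (UniversalEnvelopingAlgebra.ι ℂ x)) =
      UniversalEnvelopingAlgebra.ι ℂ x
    rw [UniversalEnvelopingAlgebra.lift_ι_apply]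
    rfl
  have hu := DFunLike.congr_fun hF u
  change (UniversalEnvelopingAlgebra.lift ℂ F u : UniversalEnvelopingAlgebra ℂ L) = u at hu
  have hmem : P (UniversalEnvelopingAlgebra.lift ℂ F u : UniversalEnvelopingAlgebra ℂ L) :=
    (UniversalEnvelopingAlgebra.lift ℂ F u).2
  rwa [hu] at hmem

variable (B : LieSubalgebra ℂ L)
  (V : Type*) [AddCommGroup V] [Module ℂ V] [LieRingModule B V] [LieModule ℂ B V]

/-- The canonical map `v ↦ 1 ⊗ v` from `V` to the induced module. -/
def indOf : V →ₗ[ℂ] Ind B V :=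
  ((balancing B V).mkQ.restrictScalars ℂ) ∘ₗ
    TensorProduct.mk ℂ (UniversalEnvelopingAlgebra ℂ L) V 1

theorem mk_tmul_eq_smul_indOf (u : UniversalEnvelopingAlgebra ℂ L) (v : V) :
    (balancing B V).mkQ (u ⊗ₜ v) = u • indOf B V v := by
  rw [indOf, LinearMap.comp_apply, LinearMap.restrictScalars_apply, TensorProduct.mk_apply,
    ← map_smul, TensorProduct.smul_tmul', smul_eq_mul, mul_one]

theorem lie_indOf (b : B) (v : V) : ⁅(b : L), indOf B V v⁆ = indOf B V ⁅b, v⁆ := by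
  rw [lie_ind_def, ← mk_tmul_eq_smul_indOf]
  refine (Submodule.Quotient.eq _).2 (Submodule.subset_span
    ⟨1, UniversalEnvelopingAlgebra.ι ℂ b, v, ?_⟩)
  rw [envelopingIncl, envelopingAct, UniversalEnvelopingAlgebra.lift_ι_apply,
    UniversalEnvelopingAlgebra.lift_ι_apply, one_mul]
  rfl

variable {B V} in
/-- The induced module is generated by the image of `V`. -/
theorem mem_of_indOf_mem {P : Submodule ℂ (Ind B V)} (hP : ∀ x : L, ∀ w ∈ P, ⁅x, w⁆ ∈ P)
    (hV : ∀ v, indOf B V v ∈ P) (w : Ind B V) : w ∈ P := by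
  have hU : ∀ u : UniversalEnvelopingAlgebra ℂ L, ∀ w ∈ P, u • w ∈ P := by
    intro u
    induction u using UniversalEnvelopingAlgebra.induction_on with
    | hr r => intro w hw; rw [algebraMap_smul]; exact P.smul_mem r hw
    | hι x => exact hP x
    | hmul a b ha hb => intro w hw; rw [mul_smul]; exact ha _ (hb w hw)
    | hadd a b ha hb => intro w hw; rw [add_smul]; exact add_mem (ha w hw) (hb w hw)
  obtain ⟨t, rfl⟩ := (balancing B V).mkQ_surjective w
  induction t using TensorProduct.induction_on with
  | zero => rw [map_zero]; exact P.zero_mem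
  | tmul u v => rw [mk_tmul_eq_smul_indOf]; exact hU u _ (hV v)
  | add a b ha hb => rw [map_add]; exact add_mem ha hb

variable {B V} {S : Type*} [AddCommGroup S] [Module ℂ S] [LieRingModule L S] [LieModule ℂ L S]

/-- Frobenius reciprocity: a `B`-equivariant map from `V` to an `L`-module factors through the
induced module. -/
theorem exists_indLift (j : V →ₗ[ℂ] S) (hj : ∀ (b : B) v, j ⁅b, v⁆ = ⁅(b : L), j v⁆) :
    ∃ φ : Ind B V →ₗ⁅ℂ, L⁆ S, ∀ v, φ (indOf B V v) = j v := by
  let act : UniversalEnvelopingAlgebra ℂ L →ₐ[ℂ] Module.End ℂ S :=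
    UniversalEnvelopingAlgebra.lift ℂ (LieModule.toEnd ℂ L S)
  have hact : ∀ (x : L) (w : S), act (UniversalEnvelopingAlgebra.ι ℂ x) w = ⁅x, w⁆ := by
    intro x w
    simp only [act, UniversalEnvelopingAlgebra.lift_ι_apply, LieModule.toEnd_apply_apply]
  let ψ : UniversalEnvelopingAlgebra ℂ L ⊗[ℂ] V →ₗ[ℂ] S :=
    TensorProduct.lift (act.toLinearMap.compl₂ j)
  have hψ : ∀ u v, ψ (u ⊗ₜ v) = act u (j v) := fun u v => rfl
  have hψsmul : ∀ u t, ψ (u • t) = act u (ψ t) := by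
    intro u t
    induction t using TensorProduct.induction_on with
    | zero => simp
    | tmul a v => rw [TensorProduct.smul_tmul', hψ, hψ, smul_eq_mul, map_mul]; rfl
    | add a b ha hb => rw [smul_add, map_add, map_add, map_add, ha, hb]
  have hB : ∀ (b : UniversalEnvelopingAlgebra ℂ B) (v : V),
      act (envelopingIncl B b) (j v) = j (envelopingAct B V b v) := by
    intro b
    induction b using UniversalEnvelopingAlgebra.induction_on with
    | hr r => intro v; simp [Module.algebraMap_end_apply]
    | hι x =>
      intro v
      rw [envelopingIncl, envelopingAct, UniversalEnvelopingAlgebra.lift_ι_apply,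
        UniversalEnvelopingAlgebra.lift_ι_apply]
      exact (hact _ _).trans (hj x v).symm
    | hmul a b ha hb => intro v; simp [ha, hb]
    | hadd a b ha hb => intro v; simp [ha, hb]
  have hker : (balancing B V).restrictScalars ℂ ≤ LinearMap.ker ψ := by
    intro w hw
    rw [LinearMap.mem_ker]
    change w ∈ balancing B V at hw
    induction hw using Submodule.span_induction with
    | mem w hw =>
      obtain ⟨u, b, v, rfl⟩ := hw
      rw [map_sub, hψ, hψ, map_mul, Module.End.mul_apply, hB, sub_self]
    | zero => simp
    | add a b _ _ ha hb => rw [map_add, ha, hb, add_zero]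
    | smul u a _ ha => rw [hψsmul, ha, map_zero]
  let φ : Ind B V →ₗ[ℂ] S := (Submodule.liftQ _ ψ hker) ∘ₗ
    (Submodule.Quotient.restrictScalarsEquiv ℂ (balancing B V)).symm.toLinearMap
  have hφ : ∀ t, φ ((balancing B V).mkQ t) = ψ t := fun t => rfl
  refine ⟨{ φ with map_lie' := ?_ }, fun v => ?_⟩
  · intro x w
    obtain ⟨t, rfl⟩ := (balancing B V).mkQ_surjective w
    change φ ⁅x, _⁆ = ⁅x, φ _⁆
    rw [lie_ind_def, ← map_smul, hφ, hφ, hψsmul, hact]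
  · change φ ((balancing B V).mkQ (1 ⊗ₜ v)) = j v
    rw [hφ, hψ, map_one]
    rfl

/-! ### Modules induced from compatible subspaces -/

namespace DualPairs

variable {ι : Type*} {T : DualPairs L ι}

/-- An irreducible module is spanned by the monomials in the raising elements applied to a nonzero
compatible subspace, as these span a submodule. -/
theorem Compatible.eval_surjective [LieModule.IsIrreducible ℂ L S] {j : V →ₗ[ℂ] S}
    (hW : T.Compatible (LinearMap.range j)) (hj : j ≠ 0) : Function.Surjective (T.eval j) := by
  let P : LieSubmodule ℂ L S :=
    { toSubmodule := LinearMap.range (T.eval j)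
      lie_mem := fun {g _} hu => hW.lie_mem_range_eval g hu }
  have hP : P = ⊤ := by
    refine (IsSimpleOrder.eq_bot_or_eq_top P).resolve_left fun h => hj (LinearMap.ext fun v => ?_)
    have hv : j v ∈ P := ⟨Finsupp.single 0 v, by simp [eval_single]⟩
    rwa [h, LieSubmodule.mem_bot] at hv
  intro w
  have hw : w ∈ P := hP ▸ LieSubmodule.mem_top w
  exact hw

/-- An irreducible module is induced from `V` if both `V → S` and `V → Ind V` are compatible with
the filtration and `c` acts injectively on `V`: the evaluation map of `S` is injective and factors
through the evaluation map of `Ind V`, which is surjective. -/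
theorem nonempty_equiv_ind [LieModule.IsIrreducible ℂ L S] [Nontrivial V] {j : V →ₗ[ℂ] S}
    (hj : ∀ (b : B) v, j ⁅b, v⁆ = ⁅(b : L), j v⁆) (hinj : Function.Injective j)
    (hW : T.Compatible (LinearMap.range j)) (hI : T.Compatible (LinearMap.range (indOf B V)))
    (hc : ∀ v, ⁅T.c, j v⁆ = 0 → v = 0) : Nonempty (S ≃ₗ⁅ℂ, L⁆ Ind B V) := by
  obtain ⟨φ, hφ⟩ := exists_indLift j hj
  have hφj : (φ : Ind B V →ₗ[ℂ] S) ∘ₗ indOf B V = j := LinearMap.ext hφ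
  have hj0 : j ≠ 0 := by
    rintro rfl
    obtain ⟨v, hv⟩ := exists_ne (0 : V)
    exact hv (hinj rfl)
  have hbij : Function.Bijective φ := by
    constructor
    · refine (injective_iff_map_eq_zero φ).2 fun w hw => ?_
      obtain ⟨f, rfl⟩ := mem_of_indOf_mem (P := LinearMap.range (T.eval (indOf B V)))
        (fun x w hw => hI.lie_mem_range_eval x hw)
        (fun v => ⟨Finsupp.single 0 v, by simp [eval_single]⟩) w
      rw [map_eval, hφj] at hw
      rw [(injective_iff_map_eq_zero _).1 (hW.eval_injective hinj hc) f hw, map_zero]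
    · intro w
      obtain ⟨f, rfl⟩ := hW.eval_surjective hj0 w
      exact ⟨T.eval (indOf B V) f, by rw [map_eval, hφj]⟩
  let E := LinearEquiv.ofBijective (φ : Ind B V →ₗ[ℂ] S) hbij
  exact ⟨LieModuleEquiv.symm { φ with
    invFun := E.symm
    left_inv := E.left_inv
    right_inv := E.right_inv }⟩

/-- The inducing module is irreducible when the induced module is: if `W ⊆ V` is a nonzero
submodule, each `v ∈ V` is a combination of monomials with coefficients in `W`, and the
uniqueness of such combinations forces `v ∈ W`. -/
theorem isIrreducible_of_compatible [LieModule.IsIrreducible ℂ L S] [Nontrivial V] {j : V →ₗ[ℂ] S}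
    (hinj : Function.Injective j) (hW : T.Compatible (LinearMap.range j))
    (hsub : ∀ W : LieSubmodule ℂ B V, T.Compatible ((W : Submodule ℂ V).map j))
    (hc : ∀ v, ⁅T.c, j v⁆ = 0 → v = 0) : LieModule.IsIrreducible ℂ B V := by
  refine LieModule.IsIrreducible.mk fun W hne => ?_
  obtain ⟨w, hw, hw0⟩ := (Submodule.ne_bot_iff (W : Submodule ℂ V)).1
    fun h => hne ((LieSubmodule.toSubmodule_eq_bot W).1 h)
  refine eq_top_iff.2 fun v _ => ?_
  let i : (W : Submodule ℂ V) →ₗ[ℂ] V := (W : Submodule ℂ V).subtype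
  have hr : LinearMap.range (j ∘ₗ i) = (W : Submodule ℂ V).map j := by
    rw [LinearMap.range_comp, Submodule.range_subtype]
  have hji : j ∘ₗ i ≠ 0 := fun h => hw0 (hinj (by
    rw [map_zero]
    exact LinearMap.congr_fun h ⟨w, hw⟩))
  obtain ⟨f, hf⟩ := Compatible.eval_surjective (T := T) (hr ▸ hsub W) hji (j v)
  have h₁ : T.eval j (Finsupp.mapRange.linearMap i f) = T.eval (j ∘ₗ i) f := by
    clear hf
    induction f using Finsupp.induction_linear with
    | zero => simp
    | add f g hf hg => rw [map_add, map_add, map_add, hf, hg]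
    | single a w => simp [eval_single]
  have h₂ : T.eval j (Finsupp.single 0 v) = j v := by simp [eval_single]
  have h₃ := hW.eval_injective hinj hc (h₁.trans (hf.trans h₂.symm))
  have h₄ := DFunLike.congr_fun h₃ 0
  simp only [Finsupp.mapRange.linearMap_apply, Finsupp.mapRange_apply, Finsupp.single_eq_same]
    at h₄
  exact h₄ ▸ (f 0).2

end DualPairs

end Induction

/-! ### The subspaces `N` -/

namespace AgeHat

section Stability

variable {S : Type*} [AddCommGroup S] [Module ℂ S] [LieRingModule AgeHat S] [LieModule ℂ AgeHat S]
  {d₁ d₂ d₃ l : ℤ}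

theorem mem_N_iff {x₁ x₂ x₃ x₄ : ℤ} {v : S} :
    v ∈ N S x₁ x₂ x₃ x₄ ↔ (∀ n, x₁ < n → ⁅p n, v⁆ = 0) ∧ (∀ n, x₂ < n → ⁅e n, v⁆ = 0) ∧
      (∀ n, x₃ < n → ⁅h n, v⁆ = 0) ∧ ∀ n, x₄ < n → ⁅q n, v⁆ = 0 := by
  constructor
  · intro hv
    refine ⟨fun n hn => ?_, fun n hn => ?_, fun n hn => ?_, fun n hn => ?_⟩
    · simpa using (hv (n - x₁) (by omega)).1
    · simpa using (hv (n - x₂) (by omega)).2.1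
    · simpa using (hv (n - x₃) (by omega)).2.2.1
    · simpa using (hv (n - x₄) (by omega)).2.2.2
  · rintro ⟨hp, he, hh, hq⟩ i hi
    exact ⟨hp _ (by omega), he _ (by omega), hh _ (by omega), hq _ (by omega)⟩

theorem N_mono {x₁ x₂ x₃ x₄ y₁ y₂ y₃ y₄ : ℤ} (h₁ : x₁ ≤ y₁) (h₂ : x₂ ≤ y₂) (h₃ : x₃ ≤ y₃)
    (h₄ : x₄ ≤ y₄) : N S x₁ x₂ x₃ x₄ ≤ N S y₁ y₂ y₃ y₄ := by
  intro v hv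
  obtain ⟨hp, he, hh, hq⟩ := mem_N_iff.1 hv
  exact mem_N_iff.2 ⟨fun n hn => hp n (by omega), fun n hn => he n (by omega),
    fun n hn => hh n (by omega), fun n hn => hq n (by omega)⟩

/-- The subspace `N` cut out by the elements `lower` is stable under the subalgebra. -/
theorem lie_mem_N (hd : d₂ ≤ d₁ + d₃) (h₁ : d₂ < l)
    (hz : ∀ n, l + d₂ - d₁ ≤ n → ∀ v : S, ⁅z n, v⁆ = 0) {b : AgeHat} (hb : b ∈ subSpan d₁ d₂ d₃)
    {v : S} (hv : v ∈ N S l (l - d₃) (l - d₂) (l - d₁)) :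
    ⁅b, v⁆ ∈ N S l (l - d₃) (l - d₂) (l - d₁) := by
  induction hb using Submodule.span_induction with
  | zero => rw [zero_lie]; exact zero_mem _
  | add u w _ _ hu hw => rw [add_lie]; exact add_mem hu hw
  | smul c u _ hu => rw [smul_lie]; exact Submodule.smul_mem _ _ hu
  | mem b hb =>
    obtain ⟨hp, he, hh, hq⟩ := mem_N_iff.1 hv
    have comm : ∀ y : AgeHat, ⁅y, v⁆ = 0 → ⁅y, ⁅b, v⁆⁆ = ⁅⁅y, b⁆, v⁆ := fun y hy => by
      rw [leibniz_lie, hy, lie_zero, add_zero]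
    refine mem_N_iff.2 ⟨fun n hn => ?_, fun n hn => ?_, fun n hn => ?_, fun n hn => ?_⟩
    · rw [comm _ (hp n hn)]
      cases hb with
      | h i => rw [lie_p_h, neg_lie, hp _ (by omega), neg_zero]
      | e i => rw [lie_p_e, zero_lie]
      | p i => rw [lie_p_p, zero_lie]
      | q i => rw [lie_p_q, hz _ (by omega)]
      | z i => rw [← lie_skew, p, lie_z_gen, neg_zero, zero_lie]
      | k => rw [bracket_k, zero_lie]
    · rw [comm _ (he n hn)]
      cases hb with
      | h i => rw [lie_e_h, neg_lie, smul_lie, he _ (by omega), smul_zero, neg_zero]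
      | e i => rw [lie_e_e, zero_lie]
      | p i => rw [lie_e_p, zero_lie]
      | q i => rw [lie_e_q, hp _ (by omega)]
      | z i => rw [← lie_skew, e, lie_z_gen, neg_zero, zero_lie]
      | k => rw [bracket_k, zero_lie]
    · rw [comm _ (hh n hn)]
      cases hb with
      | h i => rw [lie_h_h, if_neg (by omega), zero_smul, zero_lie]
      | e i => rw [lie_h_e, smul_lie, he _ (by omega), smul_zero]
      | p i => rw [lie_h_p, hp _ (by omega)]
      | q i => rw [lie_h_q, neg_lie, hq _ (by omega), neg_zero]
      | z i => rw [← lie_skew, h, lie_z_gen, neg_zero, zero_lie]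
      | k => rw [bracket_k, zero_lie]
    · rw [comm _ (hq n hn)]
      cases hb with
      | h i => rw [lie_q_h, hq _ (by omega)]
      | e i => rw [lie_q_e, neg_lie, hp _ (by omega), neg_zero]
      | p i => rw [lie_q_p, neg_lie, hz _ (by omega), neg_zero]
      | q i => rw [lie_q_q, zero_lie]
      | z i => rw [← lie_skew, q, lie_z_gen, neg_zero, zero_lie]
      | k => rw [bracket_k, zero_lie]

variable (S) in
/-- The subspace `N` cut out by the elements `lower`, as a module over the subalgebra. -/
def NSub (hd : d₂ ≤ d₁ + d₃) (h₁ : d₂ < l)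
    (hz : ∀ n, l + d₂ - d₁ ≤ n → ∀ v : S, ⁅z n, v⁆ = 0) :
    LieSubmodule ℂ (sub d₁ d₂ d₃ hd) S where
  toSubmodule := N S l (l - d₃) (l - d₂) (l - d₁)
  lie_mem := fun {b _} hv => lie_mem_N hd h₁ hz b.2 hv

/-- Minimality of `l` makes `p_l` injective on the vectors killed by all `p_n` with `n > l`. -/
theorem eq_zero_of_lie_p_eq_zero {a : ℤ} (ha : Function.Injective fun v : S => ⁅p a, v⁆)
    (hl : IsLeast {x₁ : ℤ | a ≤ x₁ ∧ ∃ x₂ x₃ x₄ : ℤ, N S x₁ x₂ x₃ x₄ ≠ ⊥} l)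
    {x₂ x₃ x₄ : ℤ} {v : S} (hv : v ∈ N S l x₂ x₃ x₄) (h0 : ⁅p l, v⁆ = 0) : v = 0 := by
  rcases hl.1.1.eq_or_lt with rfl | hal
  · exact ha (by simpa using h0)
  · obtain ⟨hp, he, hh, hq⟩ := mem_N_iff.1 hv
    by_contra hne
    have hmem : v ∈ N S (l - 1) x₂ x₃ x₄ := by
      refine mem_N_iff.2 ⟨fun n hn => ?_, he, hh, hq⟩
      rcases (show l ≤ n by omega).eq_or_lt with rfl | hln
      exacts [h0, hp n hln]
    have := hl.2 (show l - 1 ∈ _ from ⟨by omega, x₂, x₃, x₄, (Submodule.ne_bot_iff _).2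
      ⟨v, hmem, hne⟩⟩)
    omega

end Stability

end AgeHat
end

/-! ### Restricted modules are induced -/

theorem mainTheorem2 (S : Type u) [AddCommGroup S] [Module ℂ S] [LieRingModule AgeHat S]
    [LieModule ℂ AgeHat S] (hsimple : LieModule.IsIrreducible ℂ AgeHat S)
    (hrestricted : AgeHat.IsRestricted S)
    (a : ℤ) (ha : Function.Injective fun v : S => ⁅AgeHat.p a, v⁆)
    (r : ℤ) (hr : (∃ v : S, ⁅AgeHat.z (r - 1), v⁆ ≠ 0) ∧
      ∀ (i : ℕ) (v : S), ⁅AgeHat.z (r + i), v⁆ = 0)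
    (l : ℤ) (hl : IsLeast {x₁ : ℤ | a ≤ x₁ ∧ ∃ x₂ x₃ x₄ : ℤ, AgeHat.N S x₁ x₂ x₃ x₄ ≠ ⊥} l)
    (l' : ℤ) (hl' : IsLeast {x₂ : ℤ | ∃ x₃ x₄ : ℤ, AgeHat.N S l x₂ x₃ x₄ ≠ ⊥} l')
    (hrl : r ≤ 2 * l - l') :
    ∃ (d₁ d₂ d₃ : ℤ) (hd : d₂ ≤ d₁ + d₃) (V : Type u) (_ : AddCommGroup V) (_ : Module ℂ V)
      (_ : LieRingModule (AgeHat.sub d₁ d₂ d₃ hd) V)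
      (_ : LieModule ℂ (AgeHat.sub d₁ d₂ d₃ hd) V),
      LieModule.IsIrreducible ℂ (AgeHat.sub d₁ d₂ d₃ hd) V ∧
      AgeHat.InductionConditions d₁ d₂ d₃ hd V ∧
      Nonempty (S ≃ₗ⁅ℂ, AgeHat⁆ Ind (AgeHat.sub d₁ d₂ d₃ hd) V) := by
  obtain ⟨x₃, x₄, hN⟩ := hl'.1
  -- With `d₁ - d₂ = l - r` and `d₃ = l - l'`, the elements required to annihilate the inducing
  -- module include exactly the `z_n` with `n ≥ r` and the `e_n` with `n > l'`. The integer `d₂` is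
  -- small enough for `N` to be nonzero and for the two gap conditions.
  obtain ⟨d₂, hd₂, hd₂x, hd₂y, hd₂z⟩ : ∃ d₂ : ℤ, d₂ + 5 ≤ l ∧ x₃ ≤ l - d₂ ∧ x₄ ≤ r - d₂ ∧
      d₂ + (l - r) + (l - l') + 5 ≤ l :=
    ⟨min (min (l - 5) (l - x₃)) (min (r - x₄) (r + l' - l - 5)), by omega, by omega, by omega,
      by omega⟩
  obtain ⟨d₁, hd₁⟩ : ∃ d₁, d₁ = d₂ + (l - r) := ⟨_, rfl⟩
  obtain ⟨d₃, hd₃⟩ : ∃ d₃, d₃ = l - l' := ⟨_, rfl⟩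
  have hd : d₂ ≤ d₁ + d₃ := by omega
  have hz : ∀ n, l + d₂ - d₁ ≤ n → ∀ v : S, ⁅AgeHat.z n, v⁆ = 0 := by
    intro n hn v
    obtain ⟨i, hi⟩ := Int.le.dest (show r ≤ n by omega)
    exact hi ▸ hr.2 i v
  let V := AgeHat.NSub S hd (show d₂ < l by omega) hz
  have hVN : ∀ v : V, (v : S) ∈ AgeHat.N S l (l - d₃) (l - d₂) (l - d₁) := fun v => v.2
  have hnon : Nontrivial V := by
    obtain ⟨v, hv, hv0⟩ := (Submodule.ne_bot_iff _).1 hN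
    exact ⟨⟨⟨v, AgeHat.N_mono le_rfl (by omega) (by omega) (by omega) hv⟩, 0,
      fun h => hv0 (congrArg Subtype.val h)⟩⟩
  have hc : ∀ v : V, ⁅AgeHat.p l, (v : S)⁆ = 0 → v = 0 := fun v h0 =>
    Subtype.ext (AgeHat.eq_zero_of_lie_p_eq_zero ha hl (hVN v) h0)
  have hann : ∀ i : ℤ, 0 < i → ∀ v : V, ⁅AgeHat.p (l + i), (v : S)⁆ = 0 ∧
      ⁅AgeHat.z (l + d₂ - d₁ + i - 1), (v : S)⁆ = 0 ∧ ⁅AgeHat.e (l - d₃ + i), (v : S)⁆ = 0 ∧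
      ⁅AgeHat.q (l - d₁ + i), (v : S)⁆ = 0 ∧ ⁅AgeHat.h (l - d₂ + i), (v : S)⁆ = 0 := by
    intro i hi v
    obtain ⟨hp, he, hh, hq⟩ := hVN v i hi
    exact ⟨hp, hz _ (by omega) _, he, hq, hh⟩
  have hcond : AgeHat.InductionConditions d₁ d₂ d₃ hd V := by
    refine ⟨l, by omega, ⟨AgeHat.p_mem (by omega), (injective_iff_map_eq_zero
      (LieModule.toEnd ℂ (AgeHat.sub d₁ d₂ d₃ hd) V ⟨AgeHat.p l, AgeHat.p_mem (by omega)⟩)).2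
        fun v hv => hc v (congrArg Subtype.val hv)⟩, fun i hi => ?_⟩
    exact ⟨⟨AgeHat.p_mem (by omega), fun v => Subtype.ext (hann i hi v).1⟩,
      ⟨AgeHat.z_mem _, fun v => Subtype.ext (hann i hi v).2.1⟩,
      ⟨AgeHat.e_mem (by omega), fun v => Subtype.ext (hann i hi v).2.2.1⟩,
      ⟨AgeHat.q_mem (by omega), fun v => Subtype.ext (hann i hi v).2.2.2.1⟩,
      ⟨AgeHat.h_mem (by omega), fun v => Subtype.ext (hann i hi v).2.2.2.2⟩⟩
  have h₂ : d₁ + d₃ + 5 ≤ l := by omega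
  let j : V →ₗ[ℂ] S := (V : Submodule ℂ S).subtype
  have hjinj : Function.Injective j := Subtype.val_injective
  have hsub : ∀ W : LieSubmodule ℂ (AgeHat.sub d₁ d₂ d₃ hd) V,
      (AgeHat.dualPairs hd hd₂ h₂).Compatible ((W : Submodule ℂ V).map j) := by
    intro W
    refine AgeHat.compatible_dualPairs hd hd₂ h₂ ?_ ?_
    · rintro b hb _ ⟨w, hw, rfl⟩
      exact ⟨⁅(⟨b, hb⟩ : AgeHat.sub d₁ d₂ d₃ hd), w⁆, W.lie_mem hw, rfl⟩
    · rintro i hi _ ⟨w, -, rfl⟩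
      exact hann i hi w
  have hW : (AgeHat.dualPairs hd hd₂ h₂).Compatible (LinearMap.range j) := by
    have := hsub ⊤
    rwa [LieSubmodule.top_toSubmodule, Submodule.map_top] at this
  have hI : (AgeHat.dualPairs hd hd₂ h₂).Compatible
      (LinearMap.range (indOf (AgeHat.sub d₁ d₂ d₃ hd) V)) := by
    refine AgeHat.compatible_dualPairs hd hd₂ h₂ ?_ ?_
    · rintro b hb _ ⟨v, rfl⟩
      exact ⟨⁅(⟨b, hb⟩ : AgeHat.sub d₁ d₂ d₃ hd), v⁆, (lie_indOf _ _ ⟨b, hb⟩ v).symm⟩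
    · rintro i hi _ ⟨v, rfl⟩
      have hkill : ∀ b ∈ AgeHat.subSpan d₁ d₂ d₃, ⁅b, (v : S)⁆ = 0 →
          ⁅b, indOf (AgeHat.sub d₁ d₂ d₃ hd) V v⁆ = 0 := by
        intro b hb h0
        have h := lie_indOf (AgeHat.sub d₁ d₂ d₃ hd) V ⟨b, hb⟩ v
        rwa [show ⁅(⟨b, hb⟩ : AgeHat.sub d₁ d₂ d₃ hd), v⁆ = 0 from Subtype.ext h0, map_zero] at h
      obtain ⟨hp, hz, he, hq, hh⟩ := hann i hi v
      exact ⟨hkill _ (AgeHat.p_mem (by omega)) hp, hkill _ (AgeHat.z_mem _) hz,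
        hkill _ (AgeHat.e_mem (by omega)) he, hkill _ (AgeHat.q_mem (by omega)) hq,
        hkill _ (AgeHat.h_mem (by omega)) hh⟩
  exact ⟨d₁, d₂, d₃, hd, V, inferInstance, inferInstance, inferInstance, inferInstance,
    DualPairs.isIrreducible_of_compatible hjinj hW hsub hc, hcond,
    DualPairs.nonempty_equiv_ind (fun _ _ => rfl) hjinj hW hI hc⟩
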